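/- Let $\Bbbk$ be an uncountable algebraically closed field of characteristic zero and let $X$ be a smooth irreducible quasi-projective variety over $\Bbbk$ of dimension $n$, with structure sheaf $\mathcal{O}$ and tangent sheaf $\Theta=\mathcal{D}er_{\Bbbk}(\mathcal{O})$. An étale chart of $X$ is an affine open set $U\subset X$ for which there are $x_1,\dots,x_n\in\mathcal{O}(U)$, algebraically independent over $\Bbbk$, such that $\mathcal{O}(U)$ is algebraic over $\Bbbk[x_1,\dots,x_n]$ and every $\partial/\partial x_i$ extends to a derivation of $\mathcal{O}(U)$. For an étale chart $U$ put $A=\mathcal{O}(U)$ and $V=\Theta(U)$. Let $A\#V=A\otimes_{\Bbbk}V$ be the Lie algebra with bracket $$[f\#\eta,\,g\#\mu]=f\eta(g)\#\mu-g\mu(f)\#\eta+fg\#[\eta,\mu],$$ let $\Delta$ be the kernel of the multiplication map $A\otimes_{\Bbbk}A\to A$, and let $$\widehat{J}_U=\varprojlim_k\, A\#V/(\Delta^k\otimes_A V),$$ which acts on $A$ by derivations through $(f\#\eta)(a)=f\eta(a)$. Put $$\widehat{\mathcal{AV}}(U)=A\#U(\widehat{J}_U)\big/\big\langle f\#s-1\#fs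 \;\big|\; f\in A,\ s\in\widehat{J}_U\big\rangle .$$ The étale charts form a basis of the topology of $X$, and $\widehat{\mathcal{AV}}$ denotes the sheaf of associative algebras on $X$ glued from these algebras. An $\widehat{\mathcal{AV}}$-module is a quasi-coherent sheaf of $\mathcal{O}$-modules $\mathcal{M}$ whose $\mathcal{O}$-module structure is extended to a structure of a module over the sheaf of algebras $\widehat{\mathcal{AV}}$. A sheaf of $\mathcal{O}$-modules $\mathcal{M}$ is coherent if $X$ has a cover by affine open sets $U$ such that $\mathcal{M}|_U\cong\widetilde{M}$ for a finitely generated $\mathcal{O}(U)$-module $M$. **Corollary.** Every $\widehat{\mathcal{AV}}$-module $\mathcal{M}$ that is coherent over $\mathcal{O}$ is a locally free $\mathcal{O}$-module of finite rank, i.e. a vector bundle on $X$: every point of $X$ has an open neighbourhood $U$ such that $\mathcal{M}|_U\cong\mathcal{O}_U^{\,r}$ for some natural number $r$. -/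

import Mathlib

universe u
open scoped TensorProduct

noncomputable section

set_option linter.unusedSectionVars false

namespace AVHat

section Pi

variable {ι : Type*} (L : ι → Type*) [∀ i, LieRing (L i)]

/-- A product of Lie algebras, with the componentwise bracket. -/
instance piLieRing : LieRing (∀ i, L i) where
  bracket s t i := ⁅s i, t i⁆
  add_lie s t u := funext fun i => add_lie (s i) (t i) (u i)
  lie_add s t u := funext fun i => lie_add (s i) (t i) (u i)
  lie_self s := funext fun i => lie_self (s i)
  leibniz_lie s t u := funext fun i => leibniz_lie (s i) (t i) (u i)

instance piLieAlgebra (k : Type*) [CommRing k] [∀ i, LieAlgebra k (L i)] :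
    LieAlgebra k (∀ i, L i) where
  lie_smul c s t := funext fun i => lie_smul c (s i) (t i)

end Pi

section LieRinehart

variable (k A L : Type*) [CommRing k] [CommRing A] [Algebra k A] [LieRing L] [LieAlgebra k L]
  [Module A L] [LieRingModule L A] [LieRinehartRing A L] [LieRinehartAlgebra k A L]

/-- The vector space `A ⊗ L`, carrier of the Lie algebra `A # L`. -/
def SmashLie : Type _ := A ⊗[k] L

namespace SmashLie

instance : AddCommGroup (SmashLie k A L) := inferInstanceAs (AddCommGroup (A ⊗[k] L))
instance : Module k (SmashLie k A L) := inferInstanceAs (Module k (A ⊗[k] L))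

variable {A L}

/-- The element `f # x` of `A # L`. -/
def mk (f : A) (x : L) : SmashLie k A L := f ⊗ₜ[k] x

variable {k}

@[elab_as_elim]
theorem induction {p : SmashLie k A L → Prop} (s : SmashLie k A L)
    (zero : p 0) (mk : ∀ f x, p (mk k f x)) (add : ∀ s t, p s → p t → p (s + t)) : p s :=
  TensorProduct.induction_on s zero mk add

theorem mk_add_left (f g : A) (x : L) : mk k (f + g) x = mk k f x + mk k g x :=
  TensorProduct.add_tmul f g x

theorem mk_add_right (f : A) (x y : L) : mk k f (x + y) = mk k f x + mk k f y :=
  TensorProduct.tmul_add f x y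

theorem mk_sub_left (f g : A) (x : L) : mk k (f - g) x = mk k f x - mk k g x :=
  TensorProduct.sub_tmul f g x

theorem mk_sub_right (f : A) (x y : L) : mk k f (x - y) = mk k f x - mk k f y :=
  TensorProduct.tmul_sub f x y

variable (k A L)

/-- The bilinear map `(f ⊗ x, g ⊗ y) ↦ f x(g) ⊗ y`. -/
def actAux : A ⊗[k] L →ₗ[k] A ⊗[k] L →ₗ[k] A ⊗[k] L :=
  TensorProduct.lift
    (LinearMap.mk₂ k (fun f x => LinearMap.rTensor L (LinearMap.mulLeft k f ∘ₗ LieModule.toEnd k L A x))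
      (fun f g x => by
        rw [← LinearMap.rTensor_add]; congr 1; ext a; simp [add_mul])
      (fun c f x => by
        rw [← LinearMap.rTensor_smul]; congr 1; ext a; simp)
      (fun f x y => by
        rw [← LinearMap.rTensor_add]; congr 1; ext a; simp [mul_add])
      (fun c f x => by
        rw [← LinearMap.rTensor_smul]; congr 1; ext a; simp))

/-- The bilinear map `(f # x, g # y) ↦ f x(g) # y`. -/
def act : SmashLie k A L →ₗ[k] SmashLie k A L →ₗ[k] SmashLie k A L := actAux k A L

/-- The bilinear map `(f # x, g # y) ↦ f g # [x, y]`. -/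
def brk : SmashLie k A L →ₗ[k] SmashLie k A L →ₗ[k] SmashLie k A L :=
  TensorProduct.map₂ (LinearMap.mul k A) (LieModule.toEnd k L L : L →ₗ[k] Module.End k L)

variable {k A L}

@[simp] theorem act_mk (f g : A) (x y : L) :
    act k A L (mk k f x) (mk k g y) = mk k (f * ⁅x, g⁆) y := rfl

@[simp] theorem brk_mk (f g : A) (x y : L) :
    brk k A L (mk k f x) (mk k g y) = mk k (f * g) ⁅x, y⁆ := rfl

/-- The bracket `[f # x, g # y] = f x(g) # y - g y(f) # x + f g # [x, y]` of `A # L`. -/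
instance : Bracket (SmashLie k A L) (SmashLie k A L) where
  bracket s t := act k A L s t - act k A L t s + brk k A L s t

theorem lie_def (s t : SmashLie k A L) : ⁅s, t⁆ = act k A L s t - act k A L t s + brk k A L s t :=
  rfl

theorem mk_lie_mk (f g : A) (x y : L) :
    ⁅mk k f x, mk k g y⁆ = mk k (f * ⁅x, g⁆) y - mk k (g * ⁅y, f⁆) x + mk k (f * g) ⁅x, y⁆ := rfl

theorem mk_lie_swap (x y : L) (f : A) : mk k f ⁅x, y⁆ = -mk k f ⁅y, x⁆ := by
  rw [← lie_skew x y]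
  exact TensorProduct.tmul_neg _ _

theorem add_lie' (s t u : SmashLie k A L) : ⁅s + t, u⁆ = ⁅s, u⁆ + ⁅t, u⁆ := by
  simp only [lie_def, map_add, LinearMap.add_apply]; abel

theorem lie_add' (s t u : SmashLie k A L) : ⁅s, t + u⁆ = ⁅s, t⁆ + ⁅s, u⁆ := by
  simp only [lie_def, map_add, LinearMap.add_apply]; abel

theorem brk_swap (s t : SmashLie k A L) : brk k A L s t + brk k A L t s = 0 := by
  induction s using induction with
  | zero => simp
  | add s s' hs hs' =>
    rw [map_add, map_add, LinearMap.add_apply]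
    rw [show ∀ a b c d : SmashLie k A L, a + b + (c + d) = (a + c) + (b + d) by intros; abel,
      hs, hs', add_zero]
  | mk f x =>
    induction t using induction with
    | zero => simp
    | add t t' ht ht' =>
      rw [map_add, map_add, LinearMap.add_apply]
      rw [show ∀ a b c d : SmashLie k A L, a + b + (c + d) = (a + c) + (b + d) by intros; abel,
        ht, ht', add_zero]
    | mk g y =>
      rw [brk_mk, brk_mk, mul_comm g f, ← mk_add_right, ← lie_skew, neg_add_cancel]
      exact TensorProduct.tmul_zero _ _

theorem lie_self' (s : SmashLie k A L) : ⁅s, s⁆ = 0 := by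
  rw [lie_def, sub_self, zero_add]
  induction s using induction with
  | zero => simp
  | mk f x =>
    rw [brk_mk, lie_self]
    exact TensorProduct.tmul_zero _ _
  | add s t hs ht =>
    rw [map_add (brk k A L (s + t)), map_add (brk k A L), LinearMap.add_apply, LinearMap.add_apply,
      hs, ht, zero_add, add_zero, brk_swap]

theorem zero_lie' (s : SmashLie k A L) : ⁅(0 : SmashLie k A L), s⁆ = 0 := by simp [lie_def]

theorem lie_zero' (s : SmashLie k A L) : ⁅s, (0 : SmashLie k A L)⁆ = 0 := by simp [lie_def]

theorem sub_lie' (s t u : SmashLie k A L) : ⁅s - t, u⁆ = ⁅s, u⁆ - ⁅t, u⁆ := by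
  simp only [lie_def, map_sub, LinearMap.sub_apply]; abel

theorem lie_sub' (s t u : SmashLie k A L) : ⁅s, t - u⁆ = ⁅s, t⁆ - ⁅s, u⁆ := by
  simp only [lie_def, map_sub, LinearMap.sub_apply]; abel

theorem leibniz_lie' (s t u : SmashLie k A L) : ⁅s, ⁅t, u⁆⁆ = ⁅⁅s, t⁆, u⁆ + ⁅t, ⁅s, u⁆⁆ := by
  induction s using induction with
  | zero => simp only [zero_lie', lie_zero', add_zero]
  | add s s' hs hs' => simp only [add_lie', lie_add', hs, hs']; abel
  | mk f x =>
    induction t using induction with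
    | zero => simp only [zero_lie', lie_zero', add_zero]
    | add t t' ht ht' => simp only [add_lie', lie_add', ht, ht']; abel
    | mk g y =>
      induction u using induction with
      | zero => simp only [lie_zero', add_zero]
      | add u u' hu hu' => simp only [lie_add', hu, hu']; abel
      | mk h z =>
        simp only [mk_lie_mk, lie_add', add_lie', sub_lie', lie_sub',
          LieRinehartRing.leibniz_mul_right, lie_lie, mk_add_left, mk_sub_left, mk_sub_right,
          mul_add, mul_sub, smul_eq_mul, mk_lie_swap y x]
        simp only [mul_comm, mul_left_comm]
        abel

instance : LieRing (SmashLie k A L) where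
  add_lie := add_lie'
  lie_add := lie_add'
  lie_self := lie_self'
  leibniz_lie := leibniz_lie'

instance : LieAlgebra k (SmashLie k A L) where
  lie_smul c s t := by simp only [lie_def, map_smul, LinearMap.smul_apply, smul_sub, smul_add]


variable (k A L) in
/-- `A ⊗ A` acts on `A ⊗ L` by `(a ⊗ b) (f ⊗ x) = a f ⊗ b x`. -/
def twoSided : A ⊗[k] A →ₐ[k] Module.End k (A ⊗[k] L) :=
  Module.endTensorEndAlgHom.comp
    (Algebra.TensorProduct.map (Algebra.lsmul k k A) (Algebra.lsmul k k L))

instance : Module (A ⊗[k] A) (SmashLie k A L) :=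
  
  Module.compHom (A ⊗[k] L) (twoSided k A L).toRingHom

@[simp] theorem tmul_smul_mk (a b f : A) (x : L) :
    (a ⊗ₜ[k] b) • mk k f x = mk k (a * f) (b • x) := by
  rfl


variable (k A L) in
/-- The map `A # L → L`, `f # x ↦ f x`. -/
def anchorLin : SmashLie k A L →ₗ[k] L :=
  TensorProduct.lift (LinearMap.mk₂ k (fun (f : A) (x : L) => f • x)
    (fun _ _ _ => add_smul _ _ _) (fun _ _ _ => smul_assoc _ _ _)
    (fun _ _ _ => smul_add _ _ _) (fun c f x => smul_comm f c x))

@[simp] theorem anchorLin_mk (f : A) (x : L) : anchorLin k A L (mk k f x) = f • x := rfl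

theorem anchorLin_lie (s t : SmashLie k A L) :
    anchorLin k A L ⁅s, t⁆ = ⁅anchorLin k A L s, anchorLin k A L t⁆ := by
  induction s using induction with
  | zero => simp
  | add s s' hs hs' => simp only [add_lie, map_add, hs, hs']
  | mk f x =>
    induction t using induction with
    | zero => simp
    | add t t' ht ht' => simp only [lie_add, map_add, ht, ht']
    | mk g y =>
      simp only [mk_lie_mk, map_add, map_sub, anchorLin_mk, LieRinehartRing.leibniz_smul_right]
      rw [← lie_skew (f • x) y, LieRinehartRing.leibniz_smul_right,
        LieRinehartRing.lie_smul_eq_mul, ← lie_skew x y]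
      simp only [smul_neg, smul_add, smul_smul, mul_comm g f, neg_add]
      abel

theorem anchorLin_smul (F : A ⊗[k] A) (t : SmashLie k A L) :
    anchorLin k A L (F • t) = Algebra.TensorProduct.lmul' k F • anchorLin k A L t := by
  induction F using TensorProduct.induction_on with
  | zero => simp
  | add F G hF hG => simp only [add_smul, map_add, hF, hG]
  | tmul a b =>
    induction t using induction with
    | zero => simp
    | add t t' ht ht' => simp only [smul_add, map_add, ht, ht']
    | mk g y =>
      simp only [tmul_smul_mk, anchorLin_mk, Algebra.TensorProduct.lmul'_apply_tmul, smul_smul]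
      congr 1; ring

variable (k A L) in
/-- The subspace `Δ ^ m ⊗_A L` of `A # L = (A ⊗ A) ⊗_A L`, where `Δ` is the kernel of the
multiplication map `A ⊗ A → A`. -/
def diagSubmodule (m : ℕ) : Submodule (A ⊗[k] A) (SmashLie k A L) :=
  KaehlerDifferential.ideal k A ^ m • ⊤

theorem diagSubmodule_zero : diagSubmodule k A L 0 = ⊤ := by
  simp [diagSubmodule]

theorem diagSubmodule_succ (m : ℕ) :
    diagSubmodule k A L (m + 1) = KaehlerDifferential.ideal k A • diagSubmodule k A L m := by
  rw [diagSubmodule, diagSubmodule, pow_succ', Submodule.mul_smul]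

theorem diagSubmodule_succ_le (m : ℕ) :
    diagSubmodule k A L (m + 1) ≤ diagSubmodule k A L m := by
  rw [diagSubmodule_succ]; exact Submodule.smul_le_right

theorem mem_ideal_iff (F : A ⊗[k] A) :
    F ∈ KaehlerDifferential.ideal k A ↔ Algebra.TensorProduct.lmul' k F = 0 := by
  rfl

theorem anchorLin_eq_zero {m : ℕ} {t : SmashLie k A L} (ht : t ∈ diagSubmodule k A L (m + 1)) :
    anchorLin k A L t = 0 := by
  rw [diagSubmodule_succ] at ht
  refine Submodule.smul_induction_on ht (fun F hF t _ => ?_) (fun s t hs ht => ?_)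
  · rw [anchorLin_smul, (mem_ideal_iff F).1 hF, zero_smul]
  · rw [map_add, hs, ht, add_zero]

/-- The derivation `b ⊗ c ↦ a x(b) ⊗ c + a b ⊗ x(c)` of `A ⊗ A`. -/
def tensorDer (a : A) (x : L) : A ⊗[k] A →ₗ[k] A ⊗[k] A :=
  LinearMap.mulLeft k (a ⊗ₜ[k] (1 : A)) ∘ₗ
    (LinearMap.rTensor A (LieModule.toEnd k L A x) + LinearMap.lTensor A (LieModule.toEnd k L A x))

theorem tensorDer_tmul (a b c : A) (x : L) :
    tensorDer (k := k) a x (b ⊗ₜ[k] c) = (a * ⁅x, b⁆) ⊗ₜ[k] c + (a * b) ⊗ₜ[k] ⁅x, c⁆ := by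
  simp [tensorDer, mul_add]

theorem lmul_tensorDer (a : A) (x : L) (F : A ⊗[k] A) :
    Algebra.TensorProduct.lmul' k (tensorDer a x F) =
      a * ⁅x, Algebra.TensorProduct.lmul' k F⁆ := by
  induction F using TensorProduct.induction_on with
  | zero => simp
  | add F G hF hG => simp only [map_add, hF, hG, lie_add, mul_add]
  | tmul b c =>
    simp only [tensorDer_tmul, map_add, Algebra.TensorProduct.lmul'_apply_tmul,
      LieRinehartRing.leibniz_mul_right, smul_eq_mul]
    ring

theorem mk_lie_smul (a : A) (x : L) (F : A ⊗[k] A) (t : SmashLie k A L) :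
    ⁅mk k a x, F • t⁆ = F • ⁅mk k a x, t⁆ + tensorDer a x F • t
      - (Algebra.TensorProduct.lmul' k F ⊗ₜ[k] (1 : A) - F) •
        mk k ⁅anchorLin k A L t, a⁆ x := by
  induction F using TensorProduct.induction_on with
  | zero => simp
  | add F G hF hG =>
    simp only [add_smul, map_add, hF, hG, lie_add, sub_smul, TensorProduct.add_tmul]; abel
  | tmul b c =>
    induction t using induction with
    | zero =>
      have : mk k (0 : A) x = 0 := TensorProduct.zero_tmul _ _
      simp [this]
    | add t t' ht ht' =>
      simp only [smul_add, map_add, ht, ht', lie_add, add_lie, mk_add_left]; abel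
    | mk g y =>
      simp only [tmul_smul_mk, mk_lie_mk, tensorDer_tmul, add_smul, sub_smul, smul_add, smul_sub,
        anchorLin_mk, Algebra.TensorProduct.lmul'_apply_tmul, one_smul,
        LieRinehartRing.leibniz_smul_right, LieRinehartRing.leibniz_mul_right,
        LieRinehartRing.lie_smul_eq_mul, mk_add_left, mk_add_right, mul_add, smul_eq_mul]
      simp only [mul_comm, mul_left_comm]
      abel

theorem lie_mem_diagSubmodule (m : ℕ) (s : SmashLie k A L) {t : SmashLie k A L}
    (ht : t ∈ diagSubmodule k A L m) : ⁅s, t⁆ ∈ diagSubmodule k A L m := by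
  induction s using induction with
  | zero => simp
  | add s s' hs hs' => rw [add_lie]; exact add_mem hs hs'
  | mk a x =>
    induction m generalizing t with
    | zero => rw [diagSubmodule_zero]; trivial
    | succ m ih =>
      rw [diagSubmodule_succ] at ht ⊢
      refine Submodule.smul_induction_on ht (fun F hF t ht => ?_) (fun s t hs ht => ?_)
      · have hF0 := (mem_ideal_iff F).1 hF
        rw [mk_lie_smul, hF0, TensorProduct.zero_tmul, zero_sub, neg_smul, sub_neg_eq_add]
        refine add_mem (add_mem (Submodule.smul_mem_smul hF (ih ht))
          (Submodule.smul_mem_smul ?_ ht)) (Submodule.smul_mem_smul hF ?_)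
        · rw [mem_ideal_iff, lmul_tensorDer, hF0, lie_zero, mul_zero]
        · cases m with
          | zero => rw [diagSubmodule_zero]; trivial
          | succ m =>
            rw [anchorLin_eq_zero ht, zero_lie]
            have : mk k (0 : A) x = 0 := TensorProduct.zero_tmul _ _
            rw [this]; exact zero_mem _
      · rw [lie_add]; exact add_mem hs ht

theorem algebraMap_smul_eq (c : k) (t : SmashLie k A L) :
    (algebraMap k (A ⊗[k] A) c) • t = c • t := by
  change twoSided k A L (algebraMap k (A ⊗[k] A) c) t = c • t
  rw [AlgHom.commutes]; rfl

variable (k A L) in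
/-- `Δ ^ m ⊗_A L` is an ideal of the Lie algebra `A # L`. -/
def diagIdeal (m : ℕ) : LieIdeal k (SmashLie k A L) where
  carrier := diagSubmodule k A L m
  add_mem' := add_mem
  zero_mem' := zero_mem _
  smul_mem' c t ht := by
    rw [← algebraMap_smul_eq]; exact Submodule.smul_mem (diagSubmodule k A L m) _ ht
  lie_mem ht := lie_mem_diagSubmodule m _ ht

theorem mem_diagIdeal {m : ℕ} {t : SmashLie k A L} :
    t ∈ diagIdeal k A L m ↔ t ∈ diagSubmodule k A L m := Iff.rfl

variable (k) in
/-- Left multiplication by `f ∈ A` on `A # L`. -/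
def leftMul (f : A) : SmashLie k A L →ₗ[k] SmashLie k A L :=
  twoSided k A L (f ⊗ₜ[k] 1)

theorem leftMul_apply (f : A) (t : SmashLie k A L) : leftMul k f t = (f ⊗ₜ[k] (1 : A)) • t := rfl

end SmashLie

open SmashLie

/-- The quotient Lie algebra `A # L / (Δ ^ m ⊗_A L)`. -/
def JetQuot (m : ℕ) : Type _ := SmashLie k A L ⧸ diagIdeal k A L m

namespace JetQuot

instance (m : ℕ) : LieRing (JetQuot k A L m) :=
  inferInstanceAs (LieRing (SmashLie k A L ⧸ diagIdeal k A L m))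

instance (m : ℕ) : LieAlgebra k (JetQuot k A L m) :=
  inferInstanceAs (LieAlgebra k (SmashLie k A L ⧸ diagIdeal k A L m))

variable {k A L} in
/-- The quotient map `A # L → A # L / (Δ ^ m ⊗_A L)`. -/
def mk (m : ℕ) : SmashLie k A L →ₗ⁅k⁆ JetQuot k A L m where
  toFun s := LieSubmodule.Quotient.mk (N := diagIdeal k A L m) s
  map_add' _ _ := rfl
  map_smul' _ _ := rfl
  map_lie' {s t} := LieSubmodule.Quotient.mk_bracket (diagIdeal k A L m) s t

theorem mk_surjective (m : ℕ) : Function.Surjective (mk (k := k) (A := A) (L := L) m) :=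
  LieSubmodule.Quotient.surjective_mk' (diagIdeal k A L m)

/-- The projection `A # L / (Δ ^ (m + 1) ⊗_A L) → A # L / (Δ ^ m ⊗_A L)`. -/
def trans (m : ℕ) : JetQuot k A L (m + 1) →ₗ[k] JetQuot k A L m :=
  Submodule.mapQ (diagIdeal k A L (m + 1)).toSubmodule (diagIdeal k A L m).toSubmodule
    LinearMap.id (fun _ ht => diagSubmodule_succ_le m ht)

@[simp] theorem trans_mk (m : ℕ) (s : SmashLie k A L) : trans k A L m (mk (m + 1) s) = mk m s :=
  rfl

variable {A} in
/-- Left multiplication by `f ∈ A` on `A # L / (Δ ^ m ⊗_A L)`. -/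
def leftMul (m : ℕ) (f : A) : JetQuot k A L m →ₗ[k] JetQuot k A L m :=
  Submodule.mapQ (diagIdeal k A L m).toSubmodule (diagIdeal k A L m).toSubmodule
    (SmashLie.leftMul k f) (fun _ ht => Submodule.smul_mem (diagSubmodule k A L m) _ ht)

@[simp] theorem leftMul_mk (m : ℕ) (f : A) (s : SmashLie k A L) :
    leftMul k L m f (mk m s) = mk m (SmashLie.leftMul k f s) := rfl

theorem trans_lie (m : ℕ) (s t : JetQuot k A L (m + 1)) :
    trans k A L m ⁅s, t⁆ = ⁅trans k A L m s, trans k A L m t⁆ := by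
  obtain ⟨s, rfl⟩ := mk_surjective k A L _ s
  obtain ⟨t, rfl⟩ := mk_surjective k A L _ t
  rw [← LieHom.map_lie, trans_mk, trans_mk, trans_mk, LieHom.map_lie]

theorem trans_leftMul (m : ℕ) (f : A) (s : JetQuot k A L (m + 1)) :
    trans k A L m (leftMul k L (m + 1) f s) = leftMul k L m f (trans k A L m s) := by
  obtain ⟨s, rfl⟩ := mk_surjective k A L _ s
  rw [leftMul_mk, trans_mk, trans_mk, leftMul_mk]

/-- The map `A # L / (Δ ⊗_A L) → L` induced by `f # x ↦ f x`. -/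
def anchor : JetQuot k A L 1 →ₗ[k] L :=
  Submodule.liftQ (diagIdeal k A L 1).toSubmodule (anchorLin k A L)
    (fun _ ht => anchorLin_eq_zero (m := 0) ht)

@[simp] theorem anchor_mk (s : SmashLie k A L) : anchor k A L (mk 1 s) = anchorLin k A L s := rfl

theorem anchor_lie (s t : JetQuot k A L 1) :
    anchor k A L ⁅s, t⁆ = ⁅anchor k A L s, anchor k A L t⁆ := by
  obtain ⟨s, rfl⟩ := mk_surjective k A L _ s
  obtain ⟨t, rfl⟩ := mk_surjective k A L _ t
  rw [← LieHom.map_lie, anchor_mk, anchor_mk, anchor_mk, anchorLin_lie]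

end JetQuot

/-- The inverse limit `lim_m A # L / (Δ ^ m ⊗_A L)`, as a Lie subalgebra of the product. -/
def jetSubalgebra : LieSubalgebra k (∀ m : ℕ, JetQuot k A L m) where
  carrier := {s | ∀ m, JetQuot.trans k A L m (s (m + 1)) = s m}
  add_mem' hs ht m := by
    simp only [Pi.add_apply, map_add, hs m, ht m]
  zero_mem' m := by simp
  smul_mem' c s hs m := by simp only [Pi.smul_apply, map_smul, hs m]
  lie_mem' {s t} hs ht m := by
    change JetQuot.trans k A L m ⁅s (m + 1), t (m + 1)⁆ = ⁅s m, t m⁆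
    rw [JetQuot.trans_lie, hs m, ht m]

/-- The completed Lie algebra `lim_m A # L / (Δ ^ m ⊗_A L)`: with `A = 𝒪(U)` and `L = Θ(U)`,
this is the Lie algebra of jets of vector fields on `U`. -/
def Jet : Type _ := jetSubalgebra k A L

namespace Jet

instance : LieRing (Jet k A L) := inferInstanceAs (LieRing (jetSubalgebra k A L))

instance : LieAlgebra k (Jet k A L) := inferInstanceAs (LieAlgebra k (jetSubalgebra k A L))

variable {k A L}

/-- The component of `s` in `A # L / (Δ ^ m ⊗_A L)`. -/
def coeff (m : ℕ) : Jet k A L →ₗ⁅k⁆ JetQuot k A L m where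
  toFun s := s.1 m
  map_add' _ _ := rfl
  map_smul' _ _ := rfl
  map_lie' := rfl

theorem trans_coeff (m : ℕ) (s : Jet k A L) :
    JetQuot.trans k A L m (coeff (m + 1) s) = coeff m s := s.2 m

/-- The element of the inverse limit with the given components. -/
def ofCoeff (s : ∀ m, JetQuot k A L m) (h : ∀ m, JetQuot.trans k A L m (s (m + 1)) = s m) :
    Jet k A L := ⟨s, h⟩

@[simp] theorem coeff_ofCoeff (s : ∀ m, JetQuot k A L m)
    (h : ∀ m, JetQuot.trans k A L m (s (m + 1)) = s m) (m : ℕ) : coeff m (ofCoeff s h) = s m := rfl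

theorem ext {s t : Jet k A L} (h : ∀ m, coeff m s = coeff m t) : s = t :=
  Subtype.ext (funext h)

/-- The canonical map `A # L → lim_m A # L / (Δ ^ m ⊗_A L)`. -/
def of (s : SmashLie k A L) : Jet k A L := ofCoeff (fun m => JetQuot.mk m s) (fun _ => rfl)

variable (k)

/-- Left multiplication by `f ∈ A` on the completed Lie algebra. -/
def leftMul (f : A) (s : Jet k A L) : Jet k A L :=
  ofCoeff (fun m => JetQuot.leftMul k L m f (coeff m s)) fun m => by
    rw [JetQuot.trans_leftMul, trans_coeff]

variable (A L)

/-- The action of the completed Lie algebra on `A` by derivations, `(f # x) (a) = f x(a)`. -/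
def toDer : Jet k A L →ₗ⁅k⁆ Derivation k A A :=
  (LieRinehartAlgebra.anchor k A L).toLieHom.comp
    { toFun := fun s => JetQuot.anchor k A L (coeff 1 s)
      map_add' := fun s t => by rw [map_add, map_add]
      map_smul' := fun c s => by rw [map_smul, map_smul]; rfl
      map_lie' := fun {s t} => by rw [LieHom.map_lie, JetQuot.anchor_lie] }

theorem toDer_apply (s : Jet k A L) (a : A) :
    toDer k A L s a = ⁅JetQuot.anchor k A L (coeff 1 s), a⁆ := rfl

end Jet

end LieRinehart

section Smash

variable (k A g : Type*) [CommRing k] [CommRing A] [Algebra k A] [LieRing g] [LieAlgebra k g]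
  (D : g →ₗ⁅k⁆ Derivation k A A)

/-- The relations of the smash product `A # U(g)` between the generators `f ∈ A` and `x ∈ g`. -/
inductive SmashRel : FreeAlgebra k (A ⊕ g) → FreeAlgebra k (A ⊕ g) → Prop
  | algebraMap (c : k) : SmashRel (.ι k (.inl (algebraMap k A c))) (algebraMap k _ c)
  | left_add (a b : A) : SmashRel (.ι k (.inl (a + b))) (.ι k (.inl a) + .ι k (.inl b))
  | left_mul (a b : A) : SmashRel (.ι k (.inl (a * b))) (.ι k (.inl a) * .ι k (.inl b))
  | right_add (x y : g) : SmashRel (.ι k (.inr (x + y))) (.ι k (.inr x) + .ι k (.inr y))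
  | right_smul (c : k) (x : g) : SmashRel (.ι k (.inr (c • x))) (c • .ι k (.inr x))
  | right_lie (x y : g) : SmashRel (.ι k (.inr ⁅x, y⁆))
      (.ι k (.inr x) * .ι k (.inr y) - .ι k (.inr y) * .ι k (.inr x))
  | cross (x : g) (a : A) : SmashRel (.ι k (.inr x) * .ι k (.inl a))
      (.ι k (.inl (D x a)) + .ι k (.inl a) * .ι k (.inr x))

/-- The smash product `A # U(g)`, for a Lie algebra `g` acting on `A` by derivations through `D`,
presented as the associative algebra generated by the algebra `A` and the Lie algebra `g`
subject to `x f = x(f) + f x`. -/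
abbrev Smash : Type _ := RingQuot (SmashRel k A g D)

namespace Smash

variable {A g}

/-- The element `a # 1` of `A # U(g)`. -/
def inl (a : A) : Smash k A g D := RingQuot.mkAlgHom k _ (.ι k (.inl a))

/-- The element `1 # x` of `A # U(g)`. -/
def inr (x : g) : Smash k A g D := RingQuot.mkAlgHom k _ (.ι k (.inr x))

end Smash

end Smash

section Completed

variable (k A L : Type*) [CommRing k] [CommRing A] [Algebra k A] [LieRing L] [LieAlgebra k L]
  [Module A L] [LieRingModule L A] [LieRinehartRing A L] [LieRinehartAlgebra k A L]

/-- The relations `f # s = 1 # f s`, for `f ∈ A` and `s` in the completed Lie algebra. -/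
inductive CompletedRel : Smash k A (Jet k A L) (Jet.toDer k A L) →
    Smash k A (Jet k A L) (Jet.toDer k A L) → Prop
  | smul (f : A) (s : Jet k A L) : CompletedRel
      (Smash.inl k (Jet.toDer k A L) f * Smash.inr k (Jet.toDer k A L) s)
      (Smash.inr k (Jet.toDer k A L) (Jet.leftMul k f s))

/-- The completion `A # U(J) / ⟨f # s - 1 # f s⟩` of the algebra `A # U(L)`, where
`J = lim_m A # L / (Δ ^ m ⊗_A L)`. -/
abbrev Completed : Type _ := RingQuot (CompletedRel k A L)

namespace Completed

variable {A L}

/-- The image of `a ∈ A`. -/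
def inl (a : A) : Completed k A L := RingQuot.mkAlgHom k _ (Smash.inl k (Jet.toDer k A L) a)

/-- The image of `s` in the completed Lie algebra. -/
def inr (s : Jet k A L) : Completed k A L :=
  RingQuot.mkAlgHom k _ (Smash.inr k (Jet.toDer k A L) s)

end Completed

end Completed

section Functoriality

variable {k A L A' L' : Type*} [CommRing k]
  [CommRing A] [Algebra k A] [LieRing L] [LieAlgebra k L]
  [Module A L] [LieRingModule L A] [LieRinehartRing A L] [LieRinehartAlgebra k A L]
  [CommRing A'] [Algebra k A'] [LieRing L'] [LieAlgebra k L']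
  [Module A' L'] [LieRingModule L' A'] [LieRinehartRing A' L'] [LieRinehartAlgebra k A' L']
  {σ : A →ₐ[k] A'} (φ : LieRinehartAlgebra.Hom σ L L')

namespace SmashLie

/-- The map `f # x ↦ σ(f) # φ(x)`. -/
def map : SmashLie k A L →ₗ[k] SmashLie k A' L' :=
  TensorProduct.map σ.toLinearMap φ.toLieHom.toLinearMap

@[simp] theorem map_mk (f : A) (x : L) : map φ (mk k f x) = mk k (σ f) (φ x) := rfl

theorem map_lie (s t : SmashLie k A L) : map φ ⁅s, t⁆ = ⁅map φ s, map φ t⁆ := by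
  induction s using induction with
  | zero => simp
  | add s s' hs hs' => simp only [add_lie, map_add, hs, hs']
  | mk f x =>
    induction t using induction with
    | zero => simp
    | add t t' ht ht' => simp only [lie_add, map_add, ht, ht']
    | mk g y =>
      simp only [mk_lie_mk, map_add, map_sub, map_mk, map_mul, φ.apply_lie,
        LieHom.map_lie]

theorem map_smul_tensor (F : A ⊗[k] A) (t : SmashLie k A L) :
    map φ (F • t) = Algebra.TensorProduct.map σ σ F • map φ t := by
  induction F using TensorProduct.induction_on with
  | zero => simp
  | add F G hF hG => simp only [add_smul, map_add, hF, hG]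
  | tmul a b =>
    induction t using induction with
    | zero => simp
    | add t t' ht ht' => simp only [smul_add, map_add, ht, ht']
    | mk g y =>
      simp only [tmul_smul_mk, map_mk, map_mul, LieRinehartAlgebra.Hom.map_smul_apply,
        Algebra.TensorProduct.map_tmul]

theorem lmul_map (F : A ⊗[k] A) :
    Algebra.TensorProduct.lmul' k (Algebra.TensorProduct.map σ σ F) =
      σ (Algebra.TensorProduct.lmul' k F) := by
  induction F using TensorProduct.induction_on with
  | zero => simp
  | add F G hF hG => simp only [map_add, hF, hG]
  | tmul a b => simp

theorem map_mem_diagSubmodule (m : ℕ) {t : SmashLie k A L} (ht : t ∈ diagSubmodule k A L m) :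
    map φ t ∈ diagSubmodule k A' L' m := by
  induction m generalizing t with
  | zero => rw [diagSubmodule_zero]; trivial
  | succ m ih =>
    rw [diagSubmodule_succ] at ht ⊢
    refine Submodule.smul_induction_on ht (fun F hF t ht => ?_) (fun s t hs ht => ?_)
    · rw [map_smul_tensor]
      refine Submodule.smul_mem_smul ?_ (ih ht)
      rw [mem_ideal_iff, lmul_map, (mem_ideal_iff F).1 hF, map_zero]
    · rw [map_add]; exact add_mem hs ht

end SmashLie

open SmashLie

/-- The map induced by `f # x ↦ σ(f) # φ(x)` on the quotients by `Δ ^ m ⊗_A L`. -/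
def JetQuot.map (m : ℕ) : JetQuot k A L m →ₗ[k] JetQuot k A' L' m :=
  Submodule.mapQ (diagIdeal k A L m).toSubmodule (diagIdeal k A' L' m).toSubmodule
    (SmashLie.map φ) (fun _ ht => map_mem_diagSubmodule φ m ht)

@[simp] theorem JetQuot.map_mk (m : ℕ) (s : SmashLie k A L) :
    JetQuot.map φ m (JetQuot.mk m s) = JetQuot.mk m (SmashLie.map φ s) := rfl

theorem JetQuot.map_lie (m : ℕ) (s t : JetQuot k A L m) :
    JetQuot.map φ m ⁅s, t⁆ = ⁅JetQuot.map φ m s, JetQuot.map φ m t⁆ := by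
  obtain ⟨s, rfl⟩ := JetQuot.mk_surjective k A L _ s
  obtain ⟨t, rfl⟩ := JetQuot.mk_surjective k A L _ t
  rw [← LieHom.map_lie, JetQuot.map_mk, JetQuot.map_mk, JetQuot.map_mk, SmashLie.map_lie,
    LieHom.map_lie]

theorem JetQuot.map_trans (m : ℕ) (s : JetQuot k A L (m + 1)) :
    JetQuot.map φ m (JetQuot.trans k A L m s) =
      JetQuot.trans k A' L' m (JetQuot.map φ (m + 1) s) := by
  obtain ⟨s, rfl⟩ := JetQuot.mk_surjective k A L _ s
  rw [JetQuot.trans_mk, JetQuot.map_mk, JetQuot.map_mk, JetQuot.trans_mk]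

theorem JetQuot.map_leftMul (m : ℕ) (f : A) (s : JetQuot k A L m) :
    JetQuot.map φ m (JetQuot.leftMul k L m f s) =
      JetQuot.leftMul k L' m (σ f) (JetQuot.map φ m s) := by
  obtain ⟨s, rfl⟩ := JetQuot.mk_surjective k A L _ s
  rw [JetQuot.leftMul_mk, JetQuot.map_mk, JetQuot.map_mk, JetQuot.leftMul_mk,
    SmashLie.leftMul_apply, map_smul_tensor, Algebra.TensorProduct.map_tmul, map_one,
    SmashLie.leftMul_apply]

theorem JetQuot.map_anchor (s : JetQuot k A L 1) :
    JetQuot.anchor k A' L' (JetQuot.map φ 1 s) = φ (JetQuot.anchor k A L s) := by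
  obtain ⟨s, rfl⟩ := JetQuot.mk_surjective k A L _ s
  rw [JetQuot.map_mk, JetQuot.anchor_mk, JetQuot.anchor_mk]
  induction s using SmashLie.induction with
  | zero => simp
  | add s t hs ht => simp only [map_add, hs, ht]
  | mk f x => simp only [SmashLie.map_mk, anchorLin_mk, LieRinehartAlgebra.Hom.map_smul_apply]

/-- The map induced by `f # x ↦ σ(f) # φ(x)` on the completed Lie algebras. -/
def Jet.map : Jet k A L →ₗ⁅k⁆ Jet k A' L' where
  toFun s := Jet.ofCoeff (fun m => JetQuot.map φ m (Jet.coeff m s)) fun m => by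
    rw [← JetQuot.map_trans, Jet.trans_coeff]
  map_add' s t := Jet.ext fun m => by
    simp only [map_add, Jet.coeff_ofCoeff]
  map_smul' c s := Jet.ext fun m => by
    simp only [map_smul, Jet.coeff_ofCoeff, RingHom.id_apply]
  map_lie' {s t} := Jet.ext fun m => by
    simp only [LieHom.map_lie, Jet.coeff_ofCoeff, JetQuot.map_lie]

@[simp] theorem Jet.coeff_map (m : ℕ) (s : Jet k A L) :
    Jet.coeff m (Jet.map φ s) = JetQuot.map φ m (Jet.coeff m s) := rfl

theorem Jet.map_leftMul (f : A) (s : Jet k A L) :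
    Jet.map φ (Jet.leftMul k f s) = Jet.leftMul k (σ f) (Jet.map φ s) :=
  Jet.ext fun m => by
    simp only [Jet.coeff_map, Jet.leftMul, Jet.coeff_ofCoeff, JetQuot.map_leftMul]

theorem Jet.map_toDer (s : Jet k A L) (a : A) :
    Jet.toDer k A' L' (Jet.map φ s) (σ a) = σ (Jet.toDer k A L s a) := by
  rw [Jet.toDer_apply, Jet.toDer_apply, Jet.coeff_map, JetQuot.map_anchor, φ.apply_lie]

namespace Completed

variable (k) in
theorem inl_algebraMap (c : k) : inl k (L := L) (algebraMap k A c) = algebraMap k _ c := by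
  have h := congrArg (RingQuot.mkAlgHom k (CompletedRel k A L))
    (RingQuot.mkAlgHom_rel k (SmashRel.algebraMap (k := k) (D := Jet.toDer k A L) c))
  rwa [AlgHom.commutes, AlgHom.commutes] at h

theorem inl_add (a b : A) : inl k (L := L) (a + b) = inl k a + inl k b := by
  have h := congrArg (RingQuot.mkAlgHom k (CompletedRel k A L))
    (RingQuot.mkAlgHom_rel k (SmashRel.left_add (k := k) (D := Jet.toDer k A L) a b))
  rwa [map_add, map_add] at h

theorem inl_mul (a b : A) : inl k (L := L) (a * b) = inl k a * inl k b := by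
  have h := congrArg (RingQuot.mkAlgHom k (CompletedRel k A L))
    (RingQuot.mkAlgHom_rel k (SmashRel.left_mul (k := k) (D := Jet.toDer k A L) a b))
  rwa [map_mul, map_mul] at h

theorem inr_add (s t : Jet k A L) : inr k (s + t) = inr k s + inr k t := by
  have h := congrArg (RingQuot.mkAlgHom k (CompletedRel k A L))
    (RingQuot.mkAlgHom_rel k (SmashRel.right_add (k := k) (D := Jet.toDer k A L) s t))
  rwa [map_add, map_add] at h

theorem inr_smul (c : k) (s : Jet k A L) : inr k (c • s) = c • inr k s := by
  have h := congrArg (RingQuot.mkAlgHom k (CompletedRel k A L))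
    (RingQuot.mkAlgHom_rel k (SmashRel.right_smul (k := k) (D := Jet.toDer k A L) c s))
  rwa [map_smul, map_smul] at h

theorem inr_lie (s t : Jet k A L) : inr k ⁅s, t⁆ = inr k s * inr k t - inr k t * inr k s := by
  have h := congrArg (RingQuot.mkAlgHom k (CompletedRel k A L))
    (RingQuot.mkAlgHom_rel k (SmashRel.right_lie (k := k) (D := Jet.toDer k A L) s t))
  rwa [map_sub, map_sub, map_mul, map_mul, map_mul, map_mul] at h

theorem inr_mul_inl (s : Jet k A L) (a : A) :
    inr k s * inl k a = inl k (Jet.toDer k A L s a) + inl k a * inr k s := by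
  have h := congrArg (RingQuot.mkAlgHom k (CompletedRel k A L))
    (RingQuot.mkAlgHom_rel k (SmashRel.cross (k := k) (D := Jet.toDer k A L) s a))
  rwa [map_add, map_add, map_mul, map_mul, map_mul, map_mul] at h

theorem inl_mul_inr (f : A) (s : Jet k A L) :
    inl k f * inr k s = inr k (Jet.leftMul k f s) := by
  have h := RingQuot.mkAlgHom_rel k (CompletedRel.smul (k := k) (A := A) (L := L) f s)
  rwa [map_mul] at h

variable (k A L) in
/-- The structure map `A → ÂV`. -/
def inlHom : A →ₐ[k] Completed k A L :=
  AlgHom.ofLinearMap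
    { toFun := inl k
      map_add' := inl_add
      map_smul' := fun c a => by
        rw [Algebra.smul_def, inl_mul, inl_algebraMap, ← Algebra.smul_def]; rfl }
    (by
      have h := inl_algebraMap (L := L) (A := A) k 1
      rwa [map_one, map_one] at h)
    inl_mul

/-- The morphism of algebras induced by `f ↦ σ(f)` and `f # x ↦ σ(f) # φ(x)`. -/
def map : Completed k A L →ₐ[k] Completed k A' L' :=
  RingQuot.liftAlgHom k ⟨RingQuot.liftAlgHom k
    ⟨FreeAlgebra.lift k (Sum.elim (fun a => inl k (σ a)) (fun s => inr k (Jet.map φ s))), by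
      intro x y h
      cases h with
      | algebraMap c => simp [inl_algebraMap]
      | left_add a b => simp [inl_add]
      | left_mul a b => simp [inl_mul]
      | right_add s t => simp [inr_add]
      | right_smul c s => simp [inr_smul]
      | right_lie s t => simp [inr_lie]
      | cross s a => simp [inr_mul_inl, Jet.map_toDer]⟩, by
    intro x y h
    cases h with
    | smul f s => simp [Smash.inl, Smash.inr, inl_mul_inr, Jet.map_leftMul]⟩

@[simp] theorem map_inl (a : A) : map φ (inl k a) = inl k (σ a) := by
  simp [map, inl, Smash.inl]

@[simp] theorem map_inr (s : Jet k A L) : map φ (inr k s) = inr k (Jet.map φ s) := by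
  simp [map, inr, Smash.inr]

end Completed

end Functoriality

open AlgebraicGeometry CategoryTheory TopologicalSpace

section Scheme

variable (k : Type u) [Field k] (X : Scheme.{u}) [X.Over (Spec (.of k))]

/-- The `k`-algebra structure on `𝒪(U)`. -/
instance sectionsAlgebra (U : X.Opens) : Algebra k Γ(X, U) :=
  ((Scheme.ΓSpecIso (.of k)).inv ≫
    (X ↘ Spec (.of k)).appLE ⊤ U le_top).hom.toAlgebra

variable {X}

/-- The restriction map `𝒪(U) → 𝒪(V)`. -/
def res {U V : X.Opens} (h : V ≤ U) : Γ(X, U) →ₐ[k] Γ(X, V) where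
  __ := (X.presheaf.map (homOfLE h).op).hom
  commutes' c := by
    change ((((Scheme.ΓSpecIso (.of k)).inv ≫ (X ↘ Spec (.of k)).appLE ⊤ U le_top) ≫
      X.presheaf.map (homOfLE h).op).hom) c = _
    rw [Category.assoc]
    have := (X ↘ Spec (.of k)).appLE_map (U := ⊤) (V := U) le_top (homOfLE h).op
    exact congrArg (fun g => ((Scheme.ΓSpecIso (.of k)).inv ≫ g).hom c) this

theorem res_res {U V W : X.Opens} (h : V ≤ U) (h' : W ≤ V) (f : Γ(X, U)) :
    res k h' (res k h f) = res k (h'.trans h) f := by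
  change ((X.presheaf.map (homOfLE h).op ≫ X.presheaf.map (homOfLE h').op).hom) f = _
  rw [← Functor.map_comp]
  rfl

theorem res_self {U : X.Opens} (f : Γ(X, U)) : res k le_rfl f = f := by
  change (X.presheaf.map (𝟙 _)).hom f = f
  rw [X.presheaf.map_id]; rfl

/-- The `k`-derivations of the sheaf `𝒪|_U`: families of derivations of `𝒪(V)`, `V ⊆ U`,
that commute with the restriction maps. -/
def tangentSubalgebra (U : X.Opens) :
    LieSubalgebra k (∀ V : {V : X.Opens // V ≤ U}, Derivation k Γ(X, V.1) Γ(X, V.1)) where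
  carrier := {D | ∀ (V W : {V : X.Opens // V ≤ U}) (h : W.1 ≤ V.1) (f : Γ(X, V.1)),
    res k h (D V f) = D W (res k h f)}
  add_mem' hD hE V W h f := by
    simp only [Pi.add_apply, Derivation.add_apply, map_add, hD V W h f, hE V W h f]
  zero_mem' V W h f := by simp
  smul_mem' c D hD V W h f := by
    simp only [Pi.smul_apply, Derivation.smul_apply, map_smul, hD V W h f]
  lie_mem' {D E} hD hE V W h f := by
    change res k h (⁅D V, E V⁆ f) = ⁅D W, E W⁆ (res k h f)
    rw [Derivation.commutator_apply, Derivation.commutator_apply, map_sub, hD V W h, hE V W h,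
      hE V W h, hD V W h]

/-- The sections over `U` of the tangent sheaf: the `k`-derivations of the sheaf `𝒪|_U`. -/
def Tangent (U : X.Opens) : Type u := tangentSubalgebra k U

namespace Tangent

instance (U : X.Opens) : LieRing (Tangent k U) :=
  inferInstanceAs (LieRing (tangentSubalgebra k U))

instance (U : X.Opens) : LieAlgebra k (Tangent k U) :=
  inferInstanceAs (LieAlgebra k (tangentSubalgebra k U))

variable {k}

/-- The derivation of `𝒪(V)` defined by a vector field on `U ⊇ V`. -/
def der {U : X.Opens} (D : Tangent k U) (V : X.Opens) (h : V ≤ U) : Derivation k Γ(X, V) Γ(X, V) :=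
  D.1 ⟨V, h⟩

theorem ext {U : X.Opens} {D E : Tangent k U} (h : ∀ V hV f, D.der V hV f = E.der V hV f) :
    D = E :=
  Subtype.ext (funext fun V => Derivation.ext fun f => h V.1 V.2 f)

theorem res_der {U : X.Opens} (D : Tangent k U) {V W : X.Opens} (hV : V ≤ U) (h : W ≤ V)
    (f : Γ(X, V)) : res k h (D.der V hV f) = D.der W (h.trans hV) (res k h f) :=
  D.2 ⟨V, hV⟩ ⟨W, h.trans hV⟩ h f

instance (U : X.Opens) : SMul Γ(X, U) (Tangent k U) where
  smul a D := ⟨fun V => res k V.2 a • D.1 V, fun V W h f => by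
    simp only [Derivation.smul_apply, smul_eq_mul, map_mul, D.2 V W h f, res_res]⟩

@[simp] theorem smul_der {U : X.Opens} (a : Γ(X, U)) (D : Tangent k U) (V : X.Opens) (h : V ≤ U)
    (f : Γ(X, V)) : (a • D).der V h f = res k h a * D.der V h f := rfl

@[simp] theorem add_der {U : X.Opens} (D E : Tangent k U) (V : X.Opens) (h : V ≤ U)
    (f : Γ(X, V)) : (D + E).der V h f = D.der V h f + E.der V h f := rfl

@[simp] theorem zero_der {U : X.Opens} (V : X.Opens) (h : V ≤ U)
    (f : Γ(X, V)) : (0 : Tangent k U).der V h f = 0 := rfl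

@[simp] theorem ksmul_der {U : X.Opens} (c : k) (D : Tangent k U) (V : X.Opens) (h : V ≤ U)
    (f : Γ(X, V)) : (c • D).der V h f = c • D.der V h f := rfl

@[simp] theorem lie_der {U : X.Opens} (D E : Tangent k U) (V : X.Opens) (h : V ≤ U)
    (f : Γ(X, V)) : ⁅D, E⁆.der V h f = D.der V h (E.der V h f) - E.der V h (D.der V h f) :=
  Derivation.commutator_apply (D1 := D.1 ⟨V, h⟩) (D2 := E.1 ⟨V, h⟩) f

instance (U : X.Opens) : Module Γ(X, U) (Tangent k U) where
  one_smul D := ext fun V h f => by simp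
  mul_smul a b D := ext fun V h f => by simp [mul_assoc]
  smul_zero a := ext fun V h f => by simp
  smul_add a D E := ext fun V h f => by simp [mul_add]
  add_smul a b D := ext fun V h f => by simp [add_mul]
  zero_smul D := ext fun V h f => by simp

instance (U : X.Opens) : LieRingModule (Tangent k U) Γ(X, U) where
  bracket D f := D.der U le_rfl f
  add_lie D E f := rfl
  lie_add D f g := map_add _ _ _
  leibniz_lie D E f := by
    change D.der U le_rfl (E.der U le_rfl f) = ⁅D, E⁆.der U le_rfl f + E.der U le_rfl (D.der U le_rfl f)
    rw [lie_der, sub_add_cancel]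

theorem lie_apply {U : X.Opens} (D : Tangent k U) (f : Γ(X, U)) : ⁅D, f⁆ = D.der U le_rfl f := rfl

instance (U : X.Opens) : LieRinehartRing Γ(X, U) (Tangent k U) where
  lie_smul_eq_mul' a b D := by simp [lie_apply, res_self]
  leibniz_mul_right' D a b := by
    simp only [lie_apply, Derivation.leibniz, smul_eq_mul]; ring
  leibniz_smul_right' D E a := ext fun V h f => by
    simp only [lie_der, smul_der, add_der, lie_apply, Derivation.leibniz, smul_eq_mul, res_der]
    ring

instance (U : X.Opens) : LieRinehartAlgebra k Γ(X, U) (Tangent k U) where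
  smul_assoc c a D := ext fun V h f => by simp
  smul_lie c D f := rfl
  lie_smul c D f := (D.der U le_rfl).map_smul c f

/-- The restriction `Θ(U) → Θ(V)` of vector fields. -/
def restrict {U V : X.Opens} (h : V ≤ U) :
    LieRinehartAlgebra.Hom (res k h) (Tangent k U) (Tangent k V) where
  toFun D := ⟨fun W => D.1 ⟨W.1, W.2.trans h⟩, fun W W' h' f =>
    D.2 ⟨W.1, W.2.trans h⟩ ⟨W'.1, W'.2.trans h⟩ h' f⟩
  map_add' _ _ := rfl
  map_smul' _ _ := rfl
  map_lie' := rfl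
  map_smul_apply' a D := ext fun W hW f => by
    change res k _ a * _ = res k _ (res k h a) * _
    rw [res_res]; rfl
  apply_lie' f D := D.res_der le_rfl h f

end Tangent

/-- An étale chart: an affine open set `U` with `n` uniformizing parameters, i.e. functions
`x₁, …, xₙ` that are algebraically independent over `k`, such that `𝒪(U)` is algebraic over
`k[x₁, …, xₙ]` and each `∂/∂xᵢ` extends to a derivation of `𝒪(U)`. -/
def IsEtaleChart (n : ℕ) (U : X.Opens) : Prop :=
  IsAffineOpen U ∧ ∃ x : Fin n → Γ(X, U),
    AlgebraicIndependent k x ∧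
    Algebra.IsAlgebraic (Algebra.adjoin k (Set.range x)) Γ(X, U) ∧
    ∀ i, ∃ D : Derivation k Γ(X, U) Γ(X, U), ∀ j, D (x j) = if j = i then 1 else 0

/-- The algebra attached to an étale chart `U`: the completion of `𝒪(U) # U(Θ(U))`. -/
abbrev Local (U : X.Opens) : Type u := Completed k Γ(X, U) (Tangent k U)

/-- The restriction map between the algebras of two étale charts `V ⊆ U`. -/
def Local.res {U V : X.Opens} (h : V ≤ U) : Local k U →ₐ[k] Local k V :=
  Completed.map (Tangent.restrict h)

/-- The sections over an open set `W` of the sheaf of algebras `ÂV` glued from the algebras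
of the étale charts: compatible families of elements, one for each étale chart `U ⊆ W`. -/
def Sections (n : ℕ) (W : X.Opens) :
    Subalgebra k (∀ U : {U : X.Opens // IsEtaleChart k n U ∧ U ≤ W}, Local k U.1) where
  carrier := {a | ∀ (U V : {U : X.Opens // IsEtaleChart k n U ∧ U ≤ W}) (h : V.1 ≤ U.1),
    Local.res k h (a U) = a V}
  mul_mem' ha hb U V h := by simp only [Pi.mul_apply, map_mul, ha U V h, hb U V h]
  add_mem' ha hb U V h := by simp only [Pi.add_apply, map_add, ha U V h, hb U V h]
  algebraMap_mem' c U V h := by simp only [Pi.algebraMap_apply, AlgHom.commutes]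

namespace Sections

variable {n : ℕ}

/-- The restriction maps of the sheaf `ÂV`. -/
def res {W W' : X.Opens} (h : W' ≤ W) : Sections k n W →ₐ[k] Sections k n W' where
  toFun a := ⟨fun U => a.1 ⟨U.1, U.2.1, U.2.2.trans h⟩, fun U V hUV =>
    a.2 ⟨U.1, U.2.1, U.2.2.trans h⟩ ⟨V.1, V.2.1, V.2.2.trans h⟩ hUV⟩
  map_one' := rfl
  map_mul' _ _ := rfl
  map_zero' := rfl
  map_add' _ _ := rfl
  commutes' _ := rfl

/-- The structure map `𝒪 → ÂV`. -/
def ofFun (W : X.Opens) : Γ(X, W) →ₐ[k] Sections k n W :=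
  AlgHom.codRestrict
    (AlgHom.pi fun U => (Completed.inlHom k Γ(X, U.1) (Tangent k U.1)).comp (AVHat.res k U.2.2))
    (Sections k n W) (fun f U V h => by
      change Completed.map _ (Completed.inl k _) = Completed.inl k _
      rw [Completed.map_inl]
      exact congrArg _ (res_res k _ _ f))

end Sections

/-- The structure of a module over the sheaf of algebras `ÂV` on a sheaf of `𝒪`-modules `M`,
extending the given `𝒪`-module structure. -/
structure ModuleStructure (n : ℕ) (M : X.Modules) where
  /-- The action of the sections of `ÂV` over `W` on the sections of `M` over `W`. -/
  act (W : X.Opens) : Sections k n W →+* AddMonoid.End Γ(M, W)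
  act_ofFun (W : X.Opens) (f : Γ(X, W)) (m : Γ(M, W)) : act W (Sections.ofFun k W f) m = f • m
  act_res {W W' : X.Opens} (h : W' ≤ W) (a : Sections k n W) (m : Γ(M, W)) :
    M.presheaf.map (homOfLE h).op (act W a m) =
      act W' (Sections.res k h a) (M.presheaf.map (homOfLE h).op m)

attribute [local instance] MvPolynomial.gradedAlgebra

/-- `X` is quasi-projective over `k`: it is isomorphic over `k` to a locally closed subscheme of
some projective space `ℙᵐ = Proj k[T₀, …, Tₘ]`. -/
def IsQuasiProjective (X : Scheme.{u}) [X.Over (Spec (.of k))] : Prop :=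
  ∃ (m : ℕ) (i : X ⟶ Proj (MvPolynomial.homogeneousSubmodule (Fin (m + 1)) k)),
    IsImmersion i ∧
    i ≫ Proj.toSpecZero (MvPolynomial.homogeneousSubmodule (Fin (m + 1)) k) ≫
      Spec.map (CommRingCat.ofHom
        (algebraMap k (MvPolynomial.homogeneousSubmodule (Fin (m + 1)) k 0))) =
      X ↘ Spec (.of k)

/-- A sheaf of `𝒪`-modules is coherent if each point has an affine open neighbourhood `U`
such that `M|_U` is the sheaf associated with a finitely generated `𝒪(U)`-module. -/
def IsCoherent (M : X.Modules) : Prop :=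
  ∀ x : X, ∃ (U : X.Opens) (hU : IsAffineOpen U) (N : ModuleCat.{u} Γ(X, U)),
    x ∈ U ∧ Module.Finite Γ(X, U) N ∧ Nonempty (M.restrict hU.fromSpec ≅ tilde N)

/-- A sheaf of `𝒪`-modules is locally free of finite rank if each point has an open neighbourhood
`U` such that `M|_U` is isomorphic to `𝒪_U ^ r` for some natural number `r`. -/
def IsLocallyFreeOfFiniteRank (M : X.Modules) : Prop :=
  ∀ x : X, ∃ (U : X.Opens) (r : ℕ), x ∈ U ∧
    Nonempty (M.restrict U.ι ≅ (SheafOfModules.free (ULift.{u} (Fin r)) : U.toScheme.Modules))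

end Scheme
end AVHat
end

open AlgebraicGeometry CategoryTheory

noncomputable section
set_option linter.unusedSectionVars false
namespace AVHat

/-! ### Derivations along étale maps and differential simplicity. -/

section DifferentialAlgebra

/-! Through the sections `1 # η`, vector fields act on `M` by operators satisfying the Leibniz rule
(`ModuleStructure.act_ofTangent_smul`). This is all that is needed of the `ÂV`-action beyond the
`𝒪`-module structure: a finitely generated module with such operators over a differentially simple
domain is locally free.

By smoothness every point lies in an affine open set `W` whose ring `A` is étale over `k[x₁, …,
xₙ]`. The partial derivatives lift uniquely to `A` and extend to vector fields on `W`. A nonzero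
ideal of `A` stable under the lifts meets `k[x₁, …, xₙ]` nontrivially, because `A` is algebraic over
it. Differentiating a nonzero polynomial in characteristic zero then produces a nonzero constant, so
the ideal is `A` (`eq_bot_or_eq_top_of_etale`).

At a prime `p`, lift a basis of the fibre of `N = M(W)` to `e₁, …, eᵣ`; they generate `N` after
inverting some `f ∉ p`. Let `I` be the ideal of all coefficients of relations among the `eᵢ`. It
lies in `p`, and differentiating a relation gives another one, so `I` is stable under the
derivations once `f` is inverted. Its saturation by powers of `f` is therefore stable and proper,
hence zero: the `eᵢ` are independent and `N` is free where `f` is invertible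
(`exists_free_near_prime`). Since `M` is quasi-coherent on `W`, this freeness passes to the sheaf
(`nonempty_restrict_iso_free`). -/

theorem MvPolynomial.exists_pderiv_ne_zero {σ k : Type*} [Field k] [CharZero k]
    {p : MvPolynomial σ k} (hp : p.totalDegree ≠ 0) :
    ∃ i, MvPolynomial.pderiv i p ≠ 0 ∧ (MvPolynomial.pderiv i p).totalDegree < p.totalDegree := by
  classical
  obtain ⟨m, hm, i, hi⟩ : ∃ m ∈ p.support, ∃ i, m i ≠ 0 := by
    by_contra! h
    refine hp (Nat.le_zero.1 (Finset.sup_le fun m hm => ?_))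
    simp [Finsupp.sum, h m hm]
  refine ⟨i, fun h => ?_, ?_⟩
  -- The coefficient of the derivative at `m - eᵢ` is `m i` times that of `p` at `m`, nonzero in
  -- characteristic zero.
  · have h1 := MvPolynomial.coeff_pderiv (i := i) p (m - Finsupp.single i 1)
    have h2 : m - Finsupp.single i 1 + Finsupp.single i 1 = m :=
      tsub_add_cancel_of_le (by simpa [Nat.one_le_iff_ne_zero] using hi)
    rw [h, h2, MvPolynomial.coeff_zero] at h1
    have h3 := MvPolynomial.mem_support_iff.1 hm
    exact mul_ne_zero h3 (Nat.cast_add_one_ne_zero _) h1.symm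
  · rw [MvPolynomial.totalDegree, Finset.sup_lt_iff (by simpa using Nat.pos_of_ne_zero hp)]
    intro m' hm'
    have h1 := MvPolynomial.mem_support_iff.1 hm'
    rw [MvPolynomial.coeff_pderiv] at h1
    have h2 := MvPolynomial.le_totalDegree (MvPolynomial.mem_support_iff.2 (left_ne_zero_of_mul h1))
    rw [Finsupp.sum_add_index' (by simp) (by simp), Finsupp.sum_single_index rfl] at h2
    omega

/-- Polynomial rings over a field of characteristic zero are differentially simple. -/
theorem MvPolynomial.eq_top_of_pderiv_mem {σ k : Type*} [Field k] [CharZero k]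
    {J : Ideal (MvPolynomial σ k)} (hJ : ∀ i, ∀ p ∈ J, MvPolynomial.pderiv i p ∈ J)
    (hne : J ≠ ⊥) : J = ⊤ := by
  suffices H : ∀ d, ∀ p ∈ J, p ≠ 0 → p.totalDegree = d → J = ⊤ by
    obtain ⟨p, hp, hp0⟩ := Submodule.exists_mem_ne_zero_of_ne_bot hne
    exact H _ p hp hp0 rfl
  intro d
  induction d using Nat.strong_induction_on with
  | _ d ih =>
    intro p hp hp0 hd
    by_cases h0 : p.totalDegree = 0
    · rw [MvPolynomial.totalDegree_eq_zero_iff_eq_C] at h0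
      refine Ideal.eq_top_of_isUnit_mem J hp ?_
      rw [h0] at hp0 ⊢
      exact (isUnit_iff_ne_zero.2 fun h => hp0 (by rw [h, map_zero])).map MvPolynomial.C
    · obtain ⟨i, hi, hlt⟩ := MvPolynomial.exists_pderiv_ne_zero h0
      exact ih _ (hd ▸ hlt) _ (hJ i p hp) hi rfl

/-- Over the fraction field `F` of `P` the base change is unramified, hence finite, so every element
is algebraic over `F` and, clearing denominators, over `P`. By flatness `A` embeds in `F ⊗ A`. -/
theorem isAlgebraic_of_etale (P A : Type*) [CommRing P] [IsDomain P] [CommRing A] [IsDomain A]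
    [Algebra P A] [Algebra.Etale P A] : Algebra.IsAlgebraic P A := by
  refine ⟨fun a => ?_⟩
  let F := FractionRing P
  have : Module.Finite F (F ⊗[P] A) := Algebra.FormallyUnramified.finite_of_free F (F ⊗[P] A)
  have h1 : IsAlgebraic F ((1 : F) ⊗ₜ[P] a) := (Algebra.IsIntegral.isIntegral _).isAlgebraic
  have h2 : IsAlgebraic P ((1 : F) ⊗ₜ[P] a) := (IsFractionRing.isAlgebraic_iff P F _).2 h1
  have hinj : Function.Injective (Algebra.TensorProduct.includeRight : A →ₐ[P] F ⊗[P] A) :=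
    Algebra.TensorProduct.includeRight_injective (IsFractionRing.injective P F)
  exact (isAlgebraic_algHom_iff (Algebra.TensorProduct.includeRight : A →ₐ[P] F ⊗[P] A) hinj).1 h2

/-- An integral domain that is étale over a polynomial ring in characteristic zero is
differentially simple with respect to the lifts of the partial derivatives. -/
theorem eq_bot_or_eq_top_of_etale {σ k A : Type*} [Field k] [CharZero k] [CommRing A] [IsDomain A]
    [Algebra (MvPolynomial σ k) A] [Algebra.Etale (MvPolynomial σ k) A]
    (D : σ → A → A)
    (hD : ∀ i (p : MvPolynomial σ k), D i (algebraMap (MvPolynomial σ k) A p) =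
      algebraMap _ A (MvPolynomial.pderiv i p))
    (I : Ideal A) (hI : ∀ i, ∀ a ∈ I, D i a ∈ I) : I = ⊥ ∨ I = ⊤ := by
  refine or_iff_not_imp_left.2 fun h => ?_
  obtain ⟨a, ha, ha0⟩ := Submodule.exists_mem_ne_zero_of_ne_bot h
  have := isAlgebraic_of_etale (MvPolynomial σ k) A
  -- The constant term of a minimal algebraic relation of `a` is a nonzero polynomial in `I`.
  have h1 := Ideal.comap_ne_bot_of_algebraic_mem ha0 ha
    (Algebra.IsAlgebraic.isAlgebraic (R := MvPolynomial σ k) a)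
  have h2 := MvPolynomial.eq_top_of_pderiv_mem (fun i p hp => by
    rw [Ideal.mem_comap, ← hD]; exact hI i _ hp) h1
  rwa [Ideal.comap_eq_top_iff] at h2

/-- `D - E` kills the image of `P`, so it is `P`-linear and factors through `Ω[A⁄P] = 0`. -/
theorem Derivation.ext_of_formallyUnramified {k P A M : Type*} [CommRing k] [CommRing P]
    [CommRing A] [Algebra k A] [Algebra P A] [Algebra.FormallyUnramified P A]
    [AddCommGroup M] [Module k M] [Module A M] {D E : Derivation k A M}
    (h : ∀ p, D (algebraMap P A p) = E (algebraMap P A p)) : D = E := by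
  let : Module P M := Module.compHom M (algebraMap P A)
  have : IsScalarTower P A M := ⟨fun p a m => by
    rw [Algebra.smul_def, mul_smul]; rfl⟩
  let d : Derivation P A M := Derivation.mk'
    { toFun := fun a => (D - E) a
      map_add' := fun _ _ => map_add _ _ _
      map_smul' := fun p a => by
        have h0 : (D - E) (algebraMap P A p) = 0 := by simp [h]
        rw [Algebra.smul_def, Derivation.leibniz, h0, smul_zero, add_zero]; rfl }
    (fun a b => (D - E).leibniz a b)
  ext a
  have h1 : d a = 0 := by
    rw [← d.liftKaehlerDifferential_comp_D a, Subsingleton.elim (KaehlerDifferential.D P A a) 0,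
      map_zero]
  exact sub_eq_zero.1 h1

/-- Both sides are `k`-derivations from `A` to `B`, viewed as an `A`-module through `σ`, and they
agree on the image of `P`. -/
theorem Derivation.map_apply_of_formallyUnramified {k P A B : Type*} [CommRing k] [CommRing P]
    [CommRing A] [CommRing B] [Algebra k A] [Algebra k B] [Algebra P A]
    [Algebra.FormallyUnramified P A] (σ : A →ₐ[k] B) (D : Derivation k A A)
    (E : Derivation k B B)
    (h : ∀ p, σ (D (algebraMap P A p)) = E (σ (algebraMap P A p))) (a : A) :
    σ (D a) = E (σ a) := by
  let : Algebra A B := σ.toRingHom.toAlgebra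
  have : IsScalarTower k A B := IsScalarTower.of_algebraMap_eq fun c => (σ.commutes c).symm
  exact congrArg (fun d : Derivation k A B => d a)
    (Derivation.ext_of_formallyUnramified (P := P)
      (D := (Algebra.linearMap A B).compDer D) (E := E.compAlgebraMap A) h)

/-- Étaleness gives `A ⊗ Ω[P⁄k] ≃ Ω[A⁄k]`, so a linear form on the differentials of `P` with values
in `A` extends to those of `A`. -/
theorem Derivation.exists_lift_of_formallyEtale {k P A : Type*} [CommRing k] [CommRing P]
    [CommRing A] [Algebra k P] [Algebra k A] [Algebra P A] [IsScalarTower k P A]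
    [Algebra.FormallyEtale P A] (d : Derivation k P P) :
    ∃ D : Derivation k A A, ∀ p, D (algebraMap P A p) = algebraMap P A (d p) := by
  let d' : Derivation k P A := (Algebra.linearMap P A).compDer d
  let L : Ω[A⁄k] →ₗ[A] A := (d'.liftKaehlerDifferential.liftBaseChange A) ∘ₗ
      (KaehlerDifferential.tensorKaehlerEquivOfFormallyEtale k P A).symm.toLinearMap
  refine ⟨L.compDer (KaehlerDifferential.D k A), fun p => ?_⟩
  simp [L, KaehlerDifferential.tensorKaehlerEquivOfFormallyEtale_symm_D_algebraMap, d']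

end DifferentialAlgebra

/-! ### Finite modules with Leibniz operators are locally free. -/

section Connection

variable {k A N ι : Type*} [CommRing k] [CommRing A] [Algebra k A] [AddCommGroup N] [Module A N]

/-- Finitely many elements that form a basis of the fibre of a finite module at a prime ideal
generate the module in a neighbourhood of that prime. -/
theorem exists_fibre_basis [Module.Finite A N] (p : Ideal A) [p.IsPrime] :
    ∃ (r : ℕ) (e : Fin r → N), (∀ c : Fin r → A, ∑ i, c i • e i = 0 → ∀ i, c i ∈ p) ∧
      ∃ f ∉ p, ∀ n : N, f • n ∈ Submodule.span A (Set.range e) := by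
  classical
  let κ := p.ResidueField
  let s : Set (κ ⊗[A] N) := Set.range fun n : N => (1 : κ) ⊗ₜ[A] n
  have hs : Submodule.span κ s = ⊤ := by
    rw [eq_top_iff]
    rintro x -
    induction x using TensorProduct.induction_on with
    | zero => exact zero_mem _
    | add x y hx hy => exact add_mem hx hy
    | tmul a n =>
      have : a ⊗ₜ[A] n = a • ((1 : κ) ⊗ₜ[A] n) := by simp [TensorProduct.smul_tmul']
      rw [this]
      exact Submodule.smul_mem _ _ (Submodule.subset_span ⟨n, rfl⟩)
  -- The vectors `1 ⊗ n` span the fibre, so a basis can be chosen among them; this provides the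
  -- lifts `e`.
  obtain ⟨b, hbs, hb, hli⟩ := exists_linearIndependent κ s
  have : Finite b := hli.finite
  let ε := Finite.equivFin b
  choose e he using fun i => hbs (ε.symm i).2
  have hspan : Submodule.span κ (Set.range fun i => (1 : κ) ⊗ₜ[A] e i) = ⊤ := by
    have : (Set.range fun i => (1 : κ) ⊗ₜ[A] e i) = b := by
      simp only [he]
      rw [show (fun i => ((ε.symm i : b) : κ ⊗[A] N)) = Subtype.val ∘ ε.symm from rfl,
        ε.symm.surjective.range_comp, Subtype.range_coe]
    rw [this, hb, hs]
  have hli' : LinearIndependent κ fun i => (1 : κ) ⊗ₜ[A] e i := by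
    have : (fun i => (1 : κ) ⊗ₜ[A] e i) = (Subtype.val : b → _) ∘ ε.symm := funext he
    rw [this]
    exact hli.comp _ ε.symm.injective
  refine ⟨_, e, fun c hc i => ?_, ?_⟩
  · have h1 : ∑ i, algebraMap A κ (c i) • ((1 : κ) ⊗ₜ[A] e i) = 0 := by
      have := congrArg (fun n => (1 : κ) ⊗ₜ[A] n) hc
      simpa [TensorProduct.tmul_sum, TensorProduct.tmul_smul] using this
    have h2 := Fintype.linearIndependent_iff.1 hli' _ h1 i
    rwa [Ideal.algebraMap_residueField_eq_zero] at h2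
  · let Q := Submodule.span A (Set.range e)
    have hsub : Subsingleton (κ ⊗[A] (N ⧸ Q)) := by
      let g : κ ⊗[A] N →ₗ[κ] κ ⊗[A] (N ⧸ Q) := Q.mkQ.baseChange κ
      have hg : Function.Surjective g :=
        LinearMap.lTensor_surjective κ Q.mkQ_surjective
      have hg0 : g = 0 := by
        refine LinearMap.ext_on_range hspan fun i => ?_
        simp only [g, LinearMap.baseChange_tmul, LinearMap.zero_apply]
        rw [Submodule.mkQ_apply, (Submodule.Quotient.mk_eq_zero Q).2
          (Submodule.subset_span ⟨i, rfl⟩), TensorProduct.tmul_zero]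
      refine ⟨fun x y => ?_⟩
      obtain ⟨x, rfl⟩ := hg x
      obtain ⟨y, rfl⟩ := hg y
      simp [hg0]
    -- Nakayama: the finite module `N ⧸ Q` has zero fibre at `p`, so `p` is outside its support and
    -- some `f ∉ p` annihilates it.
    have h1 : (⟨p, inferInstance⟩ : PrimeSpectrum A) ∉ Module.support A (N ⧸ Q) := by
      rw [Module.mem_support_iff_nontrivial_residueField_tensorProduct]
      exact not_nontrivial_iff_subsingleton.2 hsub
    rw [Module.mem_support_iff_of_finite, SetLike.not_le_iff_exists] at h1
    obtain ⟨f, hf, hfp⟩ := h1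
    refine ⟨f, hfp, fun n => ?_⟩
    rw [← Submodule.Quotient.mk_eq_zero, Submodule.Quotient.mk_smul]
    exact Module.mem_annihilator.1 hf _

/-- A finite module with operators that satisfy the Leibniz rule for derivations without proper
invariant ideals is free near each prime ideal. -/
theorem exists_free_near_prime [IsDomain A] [Module.Finite A N]
    (D : ι → Derivation k A A) (hD : ∀ I : Ideal A, (∀ i, ∀ a ∈ I, D i a ∈ I) → I = ⊥ ∨ I = ⊤)
    (δ : ι → N →+ N) (hδ : ∀ i (a : A) (n : N), δ i (a • n) = D i a • n + a • δ i n)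
    (p : Ideal A) [p.IsPrime] :
    ∃ f ∉ p, ∃ (r : ℕ) (φ : (Fin r → A) →ₗ[A] N) (ψ : N →ₗ[A] (Fin r → A)),
      ψ ∘ₗ φ = f • LinearMap.id ∧ φ ∘ₗ ψ = f • LinearMap.id := by
  obtain ⟨r, e, hrel, f, hf, hspan⟩ := exists_fibre_basis (N := N) p
  let φ : (Fin r → A) →ₗ[A] N := Fintype.linearCombination A e
  have hφr : LinearMap.range φ = Submodule.span A (Set.range e) :=
    Fintype.range_linearCombination A e
  -- `φ` is injective exactly when this ideal of coefficients of relations vanishes.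
  let I : Ideal A := Ideal.span {a | ∃ c : Fin r → A, φ c = 0 ∧ ∃ i, c i = a}
  have hIp : I ≤ p := by
    refine Ideal.span_le.2 ?_
    rintro _ ⟨c, hc, i, rfl⟩
    exact hrel c (by simpa [φ, Fintype.linearCombination_apply] using hc) i
  -- The factor `f` is needed because `δ i (e l)` lies in the span of the `e l` only after
  -- multiplication by `f`.
  have hID : ∀ i, ∀ a ∈ I, f * D i a ∈ I := by
    intro i a ha
    induction ha using Submodule.span_induction with
    | zero => simp
    | add x y _ _ hx hy => rw [map_add, mul_add]; exact add_mem hx hy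
    | smul b x hx' hx =>
      rw [smul_eq_mul, Derivation.leibniz, smul_eq_mul, smul_eq_mul]
      rw [show f * (b * D i x + x * D i b) = b * (f * D i x) + (f * D i b) * x by ring]
      exact add_mem (I.mul_mem_left _ hx) (I.mul_mem_left _ hx')
    | mem x hx =>
      obtain ⟨c, hc, j, rfl⟩ := hx
      have hcoef : ∀ l, ∃ v : Fin r → A, φ v = f • δ i (e l) := fun l => by
        have := hspan (δ i (e l))
        rwa [← hφr, LinearMap.mem_range] at this
      choose v hv using hcoef
      -- The coefficients obtained by applying `f • δ i` to the relation `∑ c l • e l = 0` and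
      -- expanding by the Leibniz rule.
      let c' : Fin r → A := (fun l => f * D i (c l)) + ∑ l, c l • v l
      have hc' : φ c' = 0 := by
        have h0 : f • δ i (φ c) = 0 := by rw [hc, map_zero, smul_zero]
        rw [← h0]
        simp only [c', map_add, map_sum, map_smul, hv]
        simp only [φ, Fintype.linearCombination_apply, map_sum, hδ, Finset.smul_sum, smul_add,
          Finset.sum_add_distrib, mul_smul]
        congr 1
        exact Finset.sum_congr rfl fun l _ => smul_comm _ _ _
      have h1 : c' j ∈ I := Ideal.subset_span ⟨c', hc', j, rfl⟩
      have h2 : (∑ l, c l • v l) j ∈ I := by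
        rw [Finset.sum_apply]
        refine sum_mem fun l _ => ?_
        rw [Pi.smul_apply, smul_eq_mul]
        exact I.mul_mem_right _ (Ideal.subset_span ⟨c, hc, l, rfl⟩)
      simpa [c'] using sub_mem h1 h2
  -- The saturation of `I` by the powers of `f`, which is stable under `D i` itself rather than only
  -- `f * D i`.
  let I' : Ideal A :=
    { carrier := {a | ∃ m : ℕ, f ^ m * a ∈ I}
      zero_mem' := ⟨0, by simp⟩
      add_mem' := by
        rintro a b ⟨m, hm⟩ ⟨l, hl⟩
        refine ⟨m + l, ?_⟩
        rw [show f ^ (m + l) * (a + b) = f ^ l * (f ^ m * a) + f ^ m * (f ^ l * b) by ring]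
        exact add_mem (I.mul_mem_left _ hm) (I.mul_mem_left _ hl)
      smul_mem' := by
        rintro b a ⟨m, hm⟩
        refine ⟨m, ?_⟩
        rw [smul_eq_mul, mul_left_comm]
        exact I.mul_mem_left _ hm }
  have hI' : I' = ⊥ := by
    refine (hD I' fun i a ha => ?_).resolve_right fun h => ?_
    · obtain ⟨m, hm⟩ := ha
      refine ⟨m + 1, ?_⟩
      -- Expanding `f * D i (f ^ m * a)` leaves `f ^ (m + 1) * D i a` and a multiple of `f ^ m * a ∈
      -- I`. The case `m = 0` is separate because the power rule contains the truncated exponent `m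
      -- - 1`.
      have h1 := hID i _ hm
      rw [Derivation.leibniz, Derivation.leibniz_pow] at h1
      simp only [smul_eq_mul, nsmul_eq_mul] at h1
      cases m with
      | zero => simpa using h1
      | succ m =>
        have h2 := I.mul_mem_left (((m + 1 : ℕ) : A) * D i f) hm
        have h3 := sub_mem h1 h2
        convert h3 using 1
        simp only [Nat.add_sub_cancel]
        ring
    -- If `I'` were everything, a power of `f` would lie in `I ≤ p`.
    · obtain ⟨m, hm⟩ := (Ideal.eq_top_iff_one I').1 h
      rw [mul_one] at hm
      exact hf (Ideal.IsPrime.mem_of_pow_mem inferInstance m (hIp hm))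
  have hker : Function.Injective φ := by
    rw [injective_iff_map_eq_zero]
    intro c hc
    funext i
    have h0 : c i ∈ I := Ideal.subset_span ⟨c, hc, i, rfl⟩
    have : c i ∈ I' := ⟨0, by simpa using h0⟩
    rw [hI'] at this
    exact this
  let Φ := LinearEquiv.ofInjective φ hker
  -- `f • n` lies in the range of the injective map `φ`; `ψ n` is its unique preimage.
  let ψ : N →ₗ[A] (Fin r → A) := Φ.symm.toLinearMap ∘ₗ
    LinearMap.codRestrict (LinearMap.range φ) (f • LinearMap.id)
      (fun n => by rw [hφr]; exact hspan n)
  have hψ : ∀ n, φ (ψ n) = f • n := fun n =>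
    congrArg Subtype.val (Φ.apply_symm_apply ⟨f • n, by rw [hφr]; exact hspan n⟩)
  refine ⟨f, hf, r, φ, ψ, LinearMap.ext fun c => hker ?_, LinearMap.ext hψ⟩
  change φ (ψ (φ c)) = φ (f • c)
  rw [hψ, map_smul]

end Connection

open AlgebraicGeometry CategoryTheory TopologicalSpace

/-! ### Extending derivations of an affine coordinate ring to vector fields. -/

section TangentSections

variable (k : Type u) [Field k] {X : Scheme.{u}} [X.Over (Spec (.of k))]

theorem res_eq_of_basicOpen {W : X.Opens} (a : Γ(X, W)) (f : Γ(X, W)) :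
    algebraMap Γ(X, W) Γ(X, X.basicOpen a) f = res k (X.basicOpen_le a) f := rfl

theorem exists_derivation_basicOpen {W : X.Opens} (hW : IsAffineOpen W)
    (D : Derivation k Γ(X, W) Γ(X, W)) (a : Γ(X, W)) :
    ∃ E : Derivation k Γ(X, X.basicOpen a) Γ(X, X.basicOpen a),
      ∀ f, E (res k (X.basicOpen_le a) f) = res k (X.basicOpen_le a) (D f) := by
  have := hW.isLocalization_basicOpen a
  have : Algebra.FormallyEtale Γ(X, W) Γ(X, X.basicOpen a) :=
    Algebra.FormallyEtale.of_isLocalization (.powers a)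
  have : IsScalarTower k Γ(X, W) Γ(X, X.basicOpen a) :=
    IsScalarTower.of_algebraMap_eq fun c => ((res k (X.basicOpen_le a)).commutes c).symm
  exact Derivation.exists_lift_of_formallyEtale D

/-- Localization is unramified, so the compatibility need only be checked on functions coming from
`W`, where both sides are the restriction of `D f`. -/
theorem res_derivation_basicOpen {W : X.Opens} (hW : IsAffineOpen W)
    (D : Derivation k Γ(X, W) Γ(X, W)) {a : Γ(X, W)} {O : X.Opens}
    (E : Derivation k Γ(X, X.basicOpen a) Γ(X, X.basicOpen a))
    (hE : ∀ f, E (res k (X.basicOpen_le a) f) = res k (X.basicOpen_le a) (D f))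
    (h : O ≤ X.basicOpen a) (E' : Derivation k Γ(X, O) Γ(X, O))
    (hE' : ∀ f, E' (res k (h.trans (X.basicOpen_le a)) f) =
      res k (h.trans (X.basicOpen_le a)) (D f)) (x : Γ(X, X.basicOpen a)) :
    res k h (E x) = E' (res k h x) := by
  have := hW.isLocalization_basicOpen a
  have : Algebra.FormallyUnramified Γ(X, W) Γ(X, X.basicOpen a) :=
    Algebra.FormallyUnramified.of_isLocalization (.powers a)
  refine Derivation.map_apply_of_formallyUnramified (P := Γ(X, W)) (res k h) E E' (fun f => ?_) x
  rw [res_eq_of_basicOpen k, hE, res_res, res_res, hE']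

/-- The overlap enters as a variable `O` with an equation, so that it can be replaced by the basic
open set of a product without transporting sections. -/
theorem exists_res_eq {V : X.Opens} {ι : Type u} (U : ι → X.Opens) (hU : ∀ i, U i ≤ V)
    (hcover : V ≤ iSup U) (s : ∀ i, Γ(X, U i))
    (hs : ∀ i j O (hi : O ≤ U i) (hj : O ≤ U j), O = U i ⊓ U j → res k hi (s i) = res k hj (s j)) :
    ∃! t : Γ(X, V), ∀ i, res k (hU i) t = s i :=
  X.sheaf.existsUnique_gluing' U V (fun i => homOfLE (hU i)) hcover s
    fun i j => hs i j _ inf_le_left inf_le_right rfl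

/-- A derivation of the coordinate ring of an affine open set extends to a vector field. -/
theorem exists_tangent {W : X.Opens} (hW : IsAffineOpen W) (D : Derivation k Γ(X, W) Γ(X, W)) :
    ∃ T : Tangent k W, ∀ f, T.der W le_rfl f = D f := by
  choose E hE using exists_derivation_basicOpen k hW D
  have hres : ∀ {a b : Γ(X, W)} {O : X.Opens} (hO : O = X.basicOpen b) (h : O ≤ X.basicOpen a) x,
      res k h (E a x) = res k hO.le (E b (res k (hO ▸ h) x)) := by
    rintro a b _ rfl h x
    rw [res_self]
    exact res_derivation_basicOpen k hW D _ (hE a) h _ (hE b) x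
  -- On an arbitrary `V ≤ W` the derivative of `f` is glued from its values on the basic open sets
  -- of `W` inside `V`. Uniqueness of the gluing then yields linearity, the Leibniz rule and
  -- compatibility with restriction.
  have key : ∀ (V : X.Opens) (hV : V ≤ W) (f : Γ(X, V)), ∃! t : Γ(X, V),
      ∀ a : {a : Γ(X, W) // X.basicOpen a ≤ V}, res k a.2 t = E a.1 (res k a.2 f) := by
    intro V hV f
    refine exists_res_eq k _ (fun a => a.2) (fun x hx => ?_) _ (fun a b O ha hb hO => ?_)
    · obtain ⟨a, ha, hxa⟩ := hW.exists_basicOpen_le ⟨x, hx⟩ (hV hx)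
      exact Opens.mem_iSup.2 ⟨⟨a, ha⟩, hxa⟩
    · have hO' : O = X.basicOpen (a.1 * b.1) := by rw [hO, Scheme.basicOpen_mul]
      rw [hres hO' ha, hres hO' hb, res_res, res_res]
  choose d hd hd' using key
  have hadd : ∀ V hV f g, d V hV (f + g) = d V hV f + d V hV g := fun V hV f g =>
    (hd' V hV _ _ fun a => by rw [map_add, hd, hd, map_add, map_add]).symm
  have hsmul : ∀ V hV (c : k) f, d V hV (c • f) = c • d V hV f := fun V hV c f =>
    (hd' V hV _ _ fun a => by rw [map_smul, hd, map_smul, Derivation.map_smul]).symm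
  have hmul : ∀ V hV f g, d V hV (f * g) = f • d V hV g + g • d V hV f := fun V hV f g =>
    (hd' V hV _ _ fun a => by
      simp only [smul_eq_mul, map_add, map_mul, hd, Derivation.leibniz]).symm
  refine ⟨⟨fun V => Derivation.mk' ⟨⟨d V.1 V.2, hadd V.1 V.2⟩, hsmul V.1 V.2⟩ (hmul V.1 V.2),
    fun V V' h f => hd' V'.1 V'.2 _ _ fun a => ?_⟩, fun f => (hd' W le_rfl f _ fun a => ?_).symm⟩
  · rw [res_res, res_res]
    exact hd V.1 V.2 f ⟨a.1, a.2.trans h⟩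
  · exact (hE a.1 f).symm

end TangentSections

/-! ### Vector fields as Leibniz operators on `ÂV`-modules. -/

section LeibnizOperators

theorem Jet.map_of {k A L A' L' : Type*} [CommRing k]
    [CommRing A] [Algebra k A] [LieRing L] [LieAlgebra k L]
    [Module A L] [LieRingModule L A] [LieRinehartRing A L] [LieRinehartAlgebra k A L]
    [CommRing A'] [Algebra k A'] [LieRing L'] [LieAlgebra k L']
    [Module A' L'] [LieRingModule L' A'] [LieRinehartRing A' L'] [LieRinehartAlgebra k A' L']
    {σ : A →ₐ[k] A'} (φ : LieRinehartAlgebra.Hom σ L L') (s : SmashLie k A L) :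
    Jet.map φ (Jet.of s) = Jet.of (SmashLie.map φ s) := rfl

theorem Jet.toDer_of_mk {k A L : Type*} [CommRing k]
    [CommRing A] [Algebra k A] [LieRing L] [LieAlgebra k L]
    [Module A L] [LieRingModule L A] [LieRinehartRing A L] [LieRinehartAlgebra k A L]
    (f : A) (x : L) (a : A) : Jet.toDer k A L (Jet.of (SmashLie.mk k f x)) a = f * ⁅x, a⁆ :=
  LieRinehartRing.lie_smul_eq_mul f a x

variable {k : Type u} [Field k] {X : Scheme.{u}} [X.Over (Spec (.of k))] {n : ℕ}

/-- The section `1 # η` of the sheaf `ÂV` defined by a vector field `η`. -/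
def Sections.ofTangent {W : X.Opens} (T : Tangent k W) : Sections k n W :=
  ⟨fun U => Completed.inr k (Jet.of (SmashLie.mk k 1 (Tangent.restrict U.2.2 T))), fun U V h => by
    change Completed.map _ (Completed.inr k _) = _
    rw [Completed.map_inr, Jet.map_of, SmashLie.map_mk, map_one]
    rfl⟩

/-- On each chart this is the defining relation `x f = x(f) + f x` of the smash product, with `x = 1
# η`. -/
theorem Sections.ofTangent_mul_ofFun {W : X.Opens} (T : Tangent k W) (f : Γ(X, W)) :
    (Sections.ofTangent T : Sections k n W) * Sections.ofFun k W f =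
      Sections.ofFun k W (T.der W le_rfl f) + Sections.ofFun k W f * Sections.ofTangent T := by
  refine Subtype.ext (funext fun U => ?_)
  refine (Completed.inr_mul_inl _ _).trans ?_
  rw [Jet.toDer_of_mk, one_mul]
  exact congrArg (fun g => Completed.inl k g + _)
    ((Tangent.restrict U.2.2).apply_lie f T).symm

/-- The commutation relation in `ÂV` read off on `M`; it makes a vector field act like a covariant
derivative. -/
theorem ModuleStructure.act_ofTangent_smul {M : X.Modules} (ρ : ModuleStructure k n M)
    {W : X.Opens} (T : Tangent k W) (f : Γ(X, W)) (m : Γ(M, W)) :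
    ρ.act W (Sections.ofTangent T) (f • m) =
      T.der W le_rfl f • m + f • ρ.act W (Sections.ofTangent T) m := by
  rw [← ρ.act_ofFun, ← ρ.act_ofFun, ← ρ.act_ofFun]
  change (ρ.act W _ * ρ.act W _) m = (ρ.act W _ + ρ.act W _ * ρ.act W _) m
  rw [← map_mul, Sections.ofTangent_mul_ofFun, map_add, map_mul]

end LeibnizOperators

/-! ### Étale coordinates on a smooth variety and freeness of the sections. -/

section Smooth

variable (k : Type u) [Field k] {X : Scheme.{u}} [X.Over (Spec (.of k))]

/-- A smooth morphism is locally standard smooth, and a standard smooth algebra of relative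
dimension `n` is étale over a polynomial ring in `n` variables. -/
theorem exists_etale_coordinates (n : ℕ) [SmoothOfRelativeDimension n (X ↘ Spec (.of k))]
    {U : X.Opens} (hU : IsAffineOpen U) {x : X} (hx : x ∈ U) :
    ∃ t : Γ(X, U), x ∈ X.basicOpen t ∧
      ∃ g : MvPolynomial (Fin n) k →ₐ[k] Γ(X, X.basicOpen t), g.Etale := by
  have h := HasRingHomProperty.appLE (P := @SmoothOfRelativeDimension n) (X ↘ Spec (.of k))
    inferInstance ⟨⊤, isAffineOpen_top _⟩ ⟨U, hU⟩ le_top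
  obtain ⟨s, hs, h⟩ := (RingHom.locally_iff_isLocalization
    RingHom.isStandardSmoothOfRelativeDimension_respectsIso _).1 h
  obtain ⟨t, ht, hxt⟩ : ∃ t ∈ s, x ∈ X.basicOpen t := by
    have h1 := (hU.iSup_basicOpen_eq_self_iff).2 hs
    rw [← h1] at hx
    obtain ⟨⟨t, ht⟩, hxt⟩ := Opens.mem_iSup.1 hx
    exact ⟨t, ht, hxt⟩
  refine ⟨t, hxt, ?_⟩
  have := hU.isLocalization_basicOpen t
  have h2 := h t ht Γ(X, X.basicOpen t)
  -- The source of the ring map so far is `Γ(Spec k, ⊤)`; it is replaced by `k`.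
  have h3 := RingHom.isStandardSmoothOfRelativeDimension_respectsIso.2 _
    (Scheme.ΓSpecIso (.of k)).symm.commRingCatIsoToRingEquiv h2
  have h4 : (algebraMap k Γ(X, X.basicOpen t)).IsStandardSmoothOfRelativeDimension n := by
    rw [← (res k (X.basicOpen_le t)).comp_algebraMap]
    exact h3
  rw [RingHom.isStandardSmoothOfRelativeDimension_algebraMap] at h4
  exact Algebra.IsStandardSmoothOfRelativeDimension.exists_etale_mvPolynomial n k _

/-- A finite module over the coordinate ring of a smooth affine variety with étale coordinates is
free near each prime ideal if it has operators satisfying the Leibniz rule for every vector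
field. -/
theorem exists_free_near_prime_of_etale [CharZero k] [IsIntegral X] {n : ℕ} {M : X.Modules}
    (ρ : ModuleStructure k n M) {W : X.Opens} (hW : IsAffineOpen W) [Nonempty W]
    [Module.Finite Γ(X, W) Γ(M, W)] (g : MvPolynomial (Fin n) k →ₐ[k] Γ(X, W)) (hg : g.Etale)
    (p : Ideal Γ(X, W)) [p.IsPrime] :
    ∃ f ∉ p, ∃ (r : ℕ) (φ : (Fin r → Γ(X, W)) →ₗ[Γ(X, W)] Γ(M, W))
      (ψ : Γ(M, W) →ₗ[Γ(X, W)] (Fin r → Γ(X, W))),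
      ψ ∘ₗ φ = f • LinearMap.id ∧ φ ∘ₗ ψ = f • LinearMap.id := by
  let : Algebra (MvPolynomial (Fin n) k) Γ(X, W) := g.toRingHom.toAlgebra
  have : IsScalarTower k (MvPolynomial (Fin n) k) Γ(X, W) :=
    IsScalarTower.of_algebraMap_eq fun c => (g.commutes c).symm
  have : Algebra.Etale (MvPolynomial (Fin n) k) Γ(X, W) := hg
  choose D hD using fun i => Derivation.exists_lift_of_formallyEtale (k := k) (A := Γ(X, W))
    (MvPolynomial.pderiv (R := k) (σ := Fin n) i)
  choose T hT using fun i => exists_tangent k hW (D i)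
  refine exists_free_near_prime D
    (eq_bot_or_eq_top_of_etale (k := k) (fun i => D i) hD)
    (fun i => ρ.act W (Sections.ofTangent (T i))) (fun i a m => ?_) p
  rw [← hT]
  exact ρ.act_ofTangent_smul _ _ _

end Smooth

/-! ### From freeness of sections to freeness of the sheaf. -/

section QuasiCoherent

theorem isQuasicoherent_of_iso {X : Scheme.{u}} {M N : X.Modules} (e : M ≅ N)
    (h : M.IsQuasicoherent) : N.IsQuasicoherent :=
  (SheafOfModules.isQuasicoherent X.ringCatSheaf).prop_of_iso e h

variable {X : Scheme.{u}} (M : X.Modules)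

/-- The map from `Spec 𝒪(W)` to `X` factors through an open immersion into `Spec 𝒪(U)`, and
restriction along it preserves quasi-coherence. -/
theorem isQuasicoherent_restrict_of_le {U W : X.Opens} (hU : IsAffineOpen U) (hW : IsAffineOpen W)
    (h : W ≤ U) (hM : (M.restrict hU.fromSpec).IsQuasicoherent) :
    (M.restrict hW.fromSpec).IsQuasicoherent := by
  let i : Spec Γ(X, W) ⟶ Spec Γ(X, U) := Spec.map (X.presheaf.map (homOfLE h).op)
  have hi : i ≫ hU.fromSpec = hW.fromSpec := hU.map_fromSpec hW (homOfLE h).op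
  have : IsOpenImmersion (i ≫ hU.fromSpec) := by rw [hi]; infer_instance
  have : IsOpenImmersion i := IsOpenImmersion.of_comp i hU.fromSpec
  exact isQuasicoherent_of_iso
    (((Scheme.Modules.restrictFunctorCongr hi).symm ≪≫
      Scheme.Modules.restrictFunctorComp i hU.fromSpec).symm.app M)
    (Scheme.Modules.isQuasicoherent_restrictFunctor i (M.restrict hU.fromSpec))

theorem finite_sections_of_iso {F G : X.Modules} (e : F ≅ G) (O : X.Opens)
    [Module.Finite Γ(X, O) Γ(F, O)] : Module.Finite Γ(X, O) Γ(G, O) := by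
  let l : Γ(F, O) →ₗ[Γ(X, O)] Γ(G, O) :=
    { toFun := e.hom.app O
      map_add' := map_add _
      map_smul' := e.hom.app_smul }
  exact Module.Finite.of_surjective l
    (ConcreteCategory.bijective_of_isIso (e.hom.app O)).2

/-- The sections over a basic open set are the localization of `N` at the powers of `t`, and
finiteness localizes. -/
theorem finite_tilde_basicOpen {R : CommRingCat.{u}} (N : ModuleCat.{u} R) [Module.Finite R N]
    (t : R) (O : (Spec R).Opens) (hO : O = PrimeSpectrum.basicOpen t) :
    Module.Finite Γ(Spec R, O) Γ(tilde N, O) := by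
  let l : N →ₗ[R] Γ(tilde N, O) := (tilde.toOpen N O).hom
  have : IsLocalizedModule (.powers t) l := by
    have h : IsLocalizedModule.Away t (tilde.toOpen N (PrimeSpectrum.basicOpen t)).hom :=
      inferInstance
    subst hO
    exact h
  have : IsLocalization.Away t Γ(Spec R, O) := by
    subst hO
    infer_instance
  exact Module.Finite.of_isLocalizedModule (.powers t) l

theorem finite_sections_image {Y : Scheme.{u}} (j : Y ⟶ X) [IsOpenImmersion j] (O : Y.Opens)
    [Module.Finite Γ(Y, O) Γ(M.restrict j, O)] : Module.Finite Γ(X, j ''ᵁ O) Γ(M, j ''ᵁ O) := by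
  let σ := (j.appIso O).symm.commRingCatIsoToRingEquiv.toRingHom
  have : RingHomSurjective σ := ⟨(j.appIso O).symm.commRingCatIsoToRingEquiv.surjective⟩
  let l : Γ(M.restrict j, O) →ₛₗ[σ] Γ(M, j ''ᵁ O) :=
    { toFun := (M.restrictAppIso j O).hom
      map_add' := map_add _
      map_smul' := fun r m => Scheme.Modules.smul_restrictAppIso_hom_apply j M O r m }
  exact Module.Finite.of_surjective l
    (ConcreteCategory.bijective_of_isIso (M.restrictAppIso j O).hom).2

theorem finite_sections_basicOpen {U : X.Opens} (hU : IsAffineOpen U) (N : ModuleCat.{u} Γ(X, U))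
    [Module.Finite Γ(X, U) N] (e : M.restrict hU.fromSpec ≅ tilde N) (t : Γ(X, U)) :
    Module.Finite Γ(X, X.basicOpen t) Γ(M, X.basicOpen t) := by
  rw [← hU.fromSpec_image_basicOpen]
  have := finite_tilde_basicOpen N t _ rfl
  have := finite_sections_of_iso e.symm (PrimeSpectrum.basicOpen t)
  exact finite_sections_image M hU.fromSpec _

/-- The global sections of the restriction of `M` to `Spec 𝒪(W)` are the sections over `W`. -/
def sectionsEquiv {W : X.Opens} (hW : IsAffineOpen W) :
    Γ(M, W) ≃ₗ[Γ(X, W)] Γ(M.restrict hW.fromSpec, ⊤) :=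
  { (M.presheaf.mapIso (eqToIso (show hW.fromSpec ''ᵁ ⊤ = W by
        rw [Scheme.Hom.image_top_eq_opensRange, hW.opensRange_fromSpec])).op
      ).addCommGroupIsoToAddEquiv with
    map_smul' := fun r m => by
      have h0 : hW.fromSpec ''ᵁ ⊤ = W := by
        rw [Scheme.Hom.image_top_eq_opensRange, hW.opensRange_fromSpec]
      -- On the target `𝒪(W)` acts through `ΓSpecIso`; `h1` and `h2` identify this with transport
      -- along the equality of open sets `h0`.
      have h1 : hW.fromSpec.appLE W ⊤ hW.fromSpec_preimage_self.ge =
          (Scheme.ΓSpecIso Γ(X, W)).inv := by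
        rw [Scheme.Hom.appLE, hW.fromSpec_app_self, Category.assoc, ← Functor.map_comp]
        exact (congrArg _ ((Spec Γ(X, W)).presheaf.map_id _)).trans (Category.comp_id _)
      have h2 := Scheme.Hom.appLE_appIso_inv hW.fromSpec hW.fromSpec_preimage_self.ge
      rw [h1] at h2
      refine (Scheme.Modules.map_smul M (eqToHom h0) r m).trans ?_
      refine congrArg (· • M.presheaf.map (eqToHom h0).op m)
        (?_ : X.presheaf.map (eqToHom h0).op r = (hW.fromSpec.appIso ⊤).inv
          ((Spec Γ(X, W)).presheaf.map (𝟙 _) ((Scheme.ΓSpecIso Γ(X, W)).inv r)))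
      rw [(Spec Γ(X, W)).presheaf.map_id]
      exact congrArg (fun g => g.hom r) h2.symm }

theorem localizedModule_map_smul_id {R Q : Type*} [CommRing R] [AddCommGroup Q] [Module R Q]
    (S : Submonoid R) (f : R) (z : LocalizedModule S Q) :
    IsLocalizedModule.map S (LocalizedModule.mkLinearMap S Q) (LocalizedModule.mkLinearMap S Q)
      (f • LinearMap.id) z = f • z := by
  rw [map_smul]
  exact congrArg (f • ·) (DFunLike.congr_fun (LocalizedModule.map_id S) z)

/-- A section of the associated sheaf is a family of elements of the localizations at primes, so the
claim is checked prime by prime. -/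
theorem tilde_map_smul_app {R : CommRingCat.{u}} (f : R) (Q : ModuleCat.{u} R)
    (O : (Spec R).Opens) (x : Γ(tilde Q, O)) :
    (tilde.map (f • 𝟙 Q)).app O x = f • x := by
  refine Eq.trans ?_
    (((tilde.modulesSpecToSheafIso Q).app (Opposite.op O)).hom.hom.map_smul f x).symm
  refine Subtype.ext (funext fun y => ?_)
  let p : PrimeSpectrum R := y.1
  exact localizedModule_map_smul_id p.asIdeal.primeCompl f (x.1 y)

/-- Both composites are multiplication by `f`, which is invertible on any open set inside the basic
open set of `f`. -/
theorem isIso_restrict_of_comp_eq_smul {R : CommRingCat.{u}} {N P : ModuleCat.{u} R} (f : R)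
    (φ : P ⟶ N) (ψ : N ⟶ P) (h : φ ≫ ψ = f • 𝟙 P) (h' : ψ ≫ φ = f • 𝟙 N)
    {Y : Scheme.{u}} (j : Y ⟶ Spec R) [IsOpenImmersion j]
    (hj : j.opensRange ≤ PrimeSpectrum.basicOpen f) :
    IsIso ((Scheme.Modules.restrictFunctor j).map (tilde.map φ)) := by
  have hunit : ∀ Q : ModuleCat.{u} R,
      IsIso ((Scheme.Modules.restrictFunctor j).map (tilde.map (f • 𝟙 Q))) := by
    intro Q
    rw [Scheme.Modules.Hom.isIso_iff_isIso_app]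
    intro O
    have hle : j ''ᵁ O ≤ PrimeSpectrum.basicOpen f := (j.image_le_opensRange O).trans hj
    have h1 := Scheme.Modules.isUnit_algebraMap_end_of_le_basicOpen (M := tilde Q) f hle
    rw [Module.End.isUnit_iff] at h1
    rw [ConcreteCategory.isIso_iff_bijective]
    have h2 : ⇑((tilde.map (f • 𝟙 Q)).app (j ''ᵁ O)) =
        ⇑(algebraMap R (Module.End R Γ(tilde Q, j ''ᵁ O)) f) :=
      funext fun x => tilde_map_smul_app f Q _ x
    exact h2 ▸ h1
  let a := (Scheme.Modules.restrictFunctor j).map (tilde.map φ)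
  let b := (Scheme.Modules.restrictFunctor j).map (tilde.map ψ)
  have h1 := hunit P
  have h2 := hunit N
  rw [← h, tilde.map_comp, Functor.map_comp] at h1
  rw [← h', tilde.map_comp, Functor.map_comp] at h2
  -- `a ≫ b` and `b ≫ a` are isomorphisms, so `a` has a retraction and a section.
  have := IsSplitMono.mk' (f := a) ⟨b ≫ inv (a ≫ b), by rw [← Category.assoc, IsIso.hom_inv_id]⟩
  have := IsSplitEpi.mk' (f := a) ⟨inv (b ≫ a) ≫ b, by rw [Category.assoc, IsIso.inv_hom_id]⟩
  exact isIso_of_mono_of_isSplitEpi a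

/-- The restriction of a free sheaf along an open immersion is free. -/
def restrictFreeIso {Y Z : Scheme.{u}} (j : Y ⟶ Z) [IsOpenImmersion j] (I : Type u) :
    Scheme.Modules.restrict (SheafOfModules.free I : Z.Modules) j ≅
      (SheafOfModules.free I : Y.Modules) :=
  let F : SheafOfModules.{u} Z.ringCatSheaf ⥤ SheafOfModules.{u} Y.ringCatSheaf :=
    Scheme.Modules.restrictFunctor j
  have h : Limits.PreservesColimitsOfSize.{u, u} (Scheme.Modules.restrictFunctor j) :=
    inferInstance
  have : Limits.PreservesColimitsOfShape (Discrete I) F :=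
    h.preservesColimitsOfShape (J := Discrete I)
  (SheafOfModules.mapFreeIso F I (Scheme.Modules.restrictUnitIso j).symm).symm

/-- Quasi-coherence makes `M` on `W` the sheaf associated with its sections, so `φ` induces a map
from a free sheaf that becomes invertible where `f` is. -/
theorem nonempty_restrict_iso_free {W : X.Opens} (hW : IsAffineOpen W)
    (hM : (M.restrict hW.fromSpec).IsQuasicoherent) (f : Γ(X, W)) (r : ℕ)
    (φ : (Fin r → Γ(X, W)) →ₗ[Γ(X, W)] Γ(M, W)) (ψ : Γ(M, W) →ₗ[Γ(X, W)] (Fin r → Γ(X, W)))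
    (h : ψ ∘ₗ φ = f • LinearMap.id) (h' : φ ∘ₗ ψ = f • LinearMap.id) :
    Nonempty (M.restrict (X.basicOpen f).ι ≅
      (SheafOfModules.free (ULift.{u} (Fin r)) : (X.basicOpen f).toScheme.Modules)) := by
  let j : (X.basicOpen f).toScheme ⟶ Spec Γ(X, W) :=
    X.homOfLE (X.basicOpen_le f) ≫ hW.isoSpec.hom
  have hj : j ≫ hW.fromSpec = (X.basicOpen f).ι := by simp [j]
  have hrange : j.opensRange ≤ PrimeSpectrum.basicOpen f := by
    rw [← hW.fromSpec_preimage_basicOpen]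
    rintro _ ⟨y, rfl⟩
    change hW.fromSpec (j y) ∈ X.basicOpen f
    rw [← Scheme.Hom.comp_apply, hj]
    exact y.2
  let R := Γ(X, W)
  let F := M.restrict hW.fromSpec
  let Q : ModuleCat.{u} R := ModuleCat.of R Γ(F, ⊤)
  -- The free module is written on finitely supported functions on a lifted index type, the form in
  -- which `tildeFinsupp` gives a free sheaf.
  let P : ModuleCat.{u} R := ModuleCat.of R (ULift.{u} (Fin r) →₀ R)
  let a : (ULift.{u} (Fin r) →₀ R) ≃ₗ[R] (Fin r → R) :=
    Finsupp.linearEquivFunOnFinite R R _ ≪≫ₗ LinearEquiv.funCongrLeft R R Equiv.ulift.symm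
  let b : Γ(M, W) ≃ₗ[R] Q := sectionsEquiv M hW
  let Φ : P ⟶ Q := ModuleCat.ofHom (b.toLinearMap ∘ₗ φ ∘ₗ a.toLinearMap)
  let Ψ : Q ⟶ P := ModuleCat.ofHom (a.symm.toLinearMap ∘ₗ ψ ∘ₗ b.symm.toLinearMap)
  have hΦ : Φ ≫ Ψ = f • 𝟙 P := by
    ext1
    refine LinearMap.ext fun x => a.injective ?_
    have := LinearMap.congr_fun h (a x)
    simpa [Φ, Ψ] using this
  have hΨ : Ψ ≫ Φ = f • 𝟙 Q := by
    ext1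
    refine LinearMap.ext fun x => b.symm.injective ?_
    have := LinearMap.congr_fun h' (b.symm x)
    simpa [Φ, Ψ] using this
  have := isIso_restrict_of_comp_eq_smul f Φ Ψ hΦ hΨ j hrange
  have : F.IsQuasicoherent := hM
  have : IsIso F.fromTildeΓ := Scheme.Modules.isIso_fromTildeΓ_of_isQuasicoherent F
  let ε : tilde Q ≅ F := @asIso _ _ _ _ F.fromTildeΓ this
  exact ⟨(Scheme.Modules.restrictFunctorCongr hj).symm.app M ≪≫
    (Scheme.Modules.restrictFunctorComp j hW.fromSpec).app M ≪≫
    (Scheme.Modules.restrictFunctor j).mapIso ε.symm ≪≫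
    (asIso ((Scheme.Modules.restrictFunctor j).map (tilde.map Φ))).symm ≪≫
    (Scheme.Modules.restrictFunctor j).mapIso (tildeFinsupp _) ≪≫ restrictFreeIso j _⟩

end QuasiCoherent

end AVHat
end

/-! ### Local freeness of coherent modules. -/

theorem mainTheorem9 (k : Type u) [Field k] [IsAlgClosed k] [CharZero k] [Uncountable k]
    (n : ℕ) (X : Scheme.{u}) [X.Over (Spec (.of k))] [IsIntegral X]
    [SmoothOfRelativeDimension n (X ↘ Spec (.of k))] (hX : AVHat.IsQuasiProjective k X)
    (M : X.Modules) (ρ : AVHat.ModuleStructure k n M) (hM : AVHat.IsCoherent M) :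
    AVHat.IsLocallyFreeOfFiniteRank M := by
  intro x
  obtain ⟨U, hU, N, hxU, hN, ⟨e⟩⟩ := hM x
  obtain ⟨t, hxt, g, hg⟩ := AVHat.exists_etale_coordinates k n hU hxU
  -- `U` carries the coherent presentation of `M`; finiteness and quasi-coherence are inherited by
  -- the smaller affine set with étale coordinates.
  have hW := hU.basicOpen t
  have : Nonempty (X.basicOpen t) := ⟨⟨x, hxt⟩⟩
  have := AVHat.finite_sections_basicOpen M hU N e t
  let p := hW.primeIdealOf ⟨x, hxt⟩
  obtain ⟨f, hf, r, φ, ψ, h, h'⟩ := AVHat.exists_free_near_prime_of_etale k ρ hW g hg p.asIdeal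
  refine ⟨X.basicOpen f, r, ?_, AVHat.nonempty_restrict_iso_free M hW
    (AVHat.isQuasicoherent_restrict_of_le M hU hW (X.basicOpen_le t)
      (AVHat.isQuasicoherent_of_iso e.symm inferInstance)) f r φ ψ h h'⟩
  -- `p` is the prime of the point `x`, so `f ∉ p` says that `x` lies in the basic open set of `f`.
  have h1 : p ∈ hW.fromSpec ⁻¹ᵁ X.basicOpen f := by
    rw [hW.fromSpec_preimage_basicOpen]
    exact hf
  have h2 : hW.fromSpec p ∈ X.basicOpen f := h1
  rwa [hW.fromSpec_primeIdealOf] at h2
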